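/- Write $T^3=(S^1)^3$ and $g^w=g_1^{w_1}g_2^{w_2}g_3^{w_3}$, $\ker w=\{g\in T^3: g^w=1\}$ for $g\in T^3$, $w\in\mathbb Z^3$. A 6-dimensional almost complex torus manifold is a compact connected 6-dimensional almost complex manifold with an effective smooth action of $T^3$ that preserves the almost complex structure and has fixed points. The weights at an isolated fixed point $p$ are the nonzero $w_1,w_2,w_3\in\mathbb Z^3$ such that the complex $T^3$-module $T_pM$ is a sum of complex lines on which $g$ acts as multiplication by $g^{w_1},g^{w_2},g^{w_3}$. A directed multigraph with edges labeled by elements of $\mathbb Z^3$ describes $M$ (whose fixed points are isolated) if its vertices can be identified with the fixed points of $M$ so that, for each fixed point $p$, the multiset of weights at $p$ consists of the labels of the edges starting at $p$ and the negatives of the labels of the edges ending at $p$, and so that the two endpoints of each edge with label $w$ lie in the same connected component of $M^{\ker w}$. Let $a,b,c$ be a basis of $\mathbb Z^3$ and let $k,l$ be integers. Let $\Gamma_1(k)$ be the labeled directed graph with vertices $p_1,\dots,p_6$ and the nine edges $$p_2\xrightarrow{a}p_1,\quad p_2\xrightarrow{a+b}p_3,\quad p_1\xrightarrow{b}p_3,\quad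 p_5\xrightarrow{a}p_6,\quad p_5\xrightarrow{a+b}p_4,\quad p_6\xrightarrow{b}p_4,$$ $$p_1\xrightarrow{c+ka}p_6,\quad p_2\xrightarrow{c}p_5,\quad p_3\xrightarrow{c+k(a+b)}p_4,$$ and let $\Gamma_2(k,l)$ be the one with the nine edges $$p_2\xrightarrow{a}p_1,\quad p_2\xrightarrow{a+b}p_3,\quad p_1\xrightarrow{b}p_3,\quad p_5\xrightarrow{a+kc}p_6,\quad p_5\xrightarrow{a+b+(k+l)c}p_4,\quad p_6\xrightarrow{b+lc}p_4,$$ $$p_1\xrightarrow{c}p_6,\quad p_2\xrightarrow{c}p_5,\quad p_3\xrightarrow{c}p_4.$$ Theorem. (1) For all integers $k$ and $l$, each of the graphs $\Gamma_1(k)$ and $\Gamma_2(k,l)$ describes some 6-dimensional almost complex torus manifold with Euler number 6. (2) Let $k\ge 0$. Then $$M_1(k)=\{([z_0:z_1:z_2:z_3],[w_0:w_1:w_2])\in\mathbb{CP}^3\times\mathbb{CP}^2 : z_0w_1^k=z_1w_0^k,\ z_1w_2^k=z_2w_1^k,\ z_0w_2^k=z_2w_0^k\}$$ is a complex submanifold;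 with its complex structure and the $T^3$-action $$g\cdot([z_0:z_1:z_2:z_3],[w_0:w_1:w_2])=([z_0:g^{ka}z_1:g^{k(a+b)}z_2:g^{-c}z_3],[w_0:g^aw_1:g^{a+b}w_2])$$ it is a 6-dimensional almost complex torus manifold with Euler number 6, and $\Gamma_1(k)$ describes it. (3) Let $k\ge 0$ and $k+l\ge 0$. Then $$M_2(k,l)=\{([z_0:z_1:z_2:z_3:z_4],[w_0:w_1])\in\mathbb{CP}^4\times\mathbb{CP}^1 : z_0w_1^k=z_3w_0^k,\ z_2w_1^{k+l}=z_4w_0^{k+l}\}$$ is a complex submanifold; with its complex structure and the $T^3$-action $$g\cdot([z_0:z_1:z_2:z_3:z_4],[w_0:w_1])=([z_0:g^{-a}z_1:g^bz_2:g^{kc}z_3:g^{b+(k+l)c}z_4],[w_0:g^cw_1])$$ it is a 6-dimensional almost complex torus manifold with Euler number 6, and $\Gamma_2(k,l)$ describes it. -/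

import Mathlib

open scoped Manifold ContDiff LinearAlgebra.Projectivization
open Topology

noncomputable section

/-! ## Complex projective space as a complex manifold -/

/-- Complex projective space `ℂℙⁿ`, with homogeneous coordinates indexed by `0, …, n`. -/
abbrev CP (n : ℕ) : Type := ℙ ℂ (Fin (n + 1) → ℂ)

namespace CP

variable {n : ℕ}

/-- The quotient topology of `ℂⁿ⁺¹ ∖ {0}`. -/
instance instTopologicalSpace : TopologicalSpace (CP n) :=
  inferInstanceAs (TopologicalSpace (Quotient (projectivizationSetoid ℂ (Fin (n + 1) → ℂ))))

theorem isQuotientMap_mk' :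
    IsQuotientMap (Projectivization.mk' ℂ : {v : Fin (n + 1) → ℂ // v ≠ 0} → CP n) :=
  isQuotientMap_quotient_mk'

/-- The `i`-th affine coordinates `[z] ↦ (z_j / z_i)_{j ≠ i}`. -/
def affineCoord (i : Fin (n + 1)) (p : CP n) : Fin n → ℂ :=
  Projectivization.lift (fun v : {v : Fin (n + 1) → ℂ // v ≠ 0} =>
      fun j : Fin n => v.1 (i.succAbove j) / v.1 i)
    (by
      rintro ⟨v, hv⟩ ⟨w, hw⟩ t h
      have ht : t ≠ 0 := by
        rintro rfl
        exact hv (by simpa using h)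
      funext j
      simp only at h
      subst h
      simp [mul_div_mul_left _ _ ht]) p

theorem affineCoord_mk (i : Fin (n + 1)) (v : Fin (n + 1) → ℂ) (hv : v ≠ 0) (j : Fin n) :
    affineCoord i (Projectivization.mk ℂ v hv) j = v (i.succAbove j) / v i := rfl

/-- The point of `ℂℙⁿ` with given `i`-th affine coordinates. -/
def ofAffine (i : Fin (n + 1)) (u : Fin n → ℂ) : CP n :=
  Projectivization.mk ℂ (i.insertNth (1 : ℂ) u : Fin (n + 1) → ℂ)
    (fun h => by simpa using congrFun h i)

/-- The set of points whose `i`-th homogeneous coordinate is nonzero. -/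
def affineSet (i : Fin (n + 1)) : Set (CP n) := {p | p.rep i ≠ 0}

theorem mk_mem_affineSet (i : Fin (n + 1)) (v : Fin (n + 1) → ℂ) (hv : v ≠ 0) :
    Projectivization.mk ℂ v hv ∈ affineSet i ↔ v i ≠ 0 := by
  obtain ⟨t, ht⟩ := Projectivization.exists_smul_eq_mk_rep ℂ v hv
  have : t.1 * v i = (Projectivization.mk ℂ v hv).rep i := congrFun ht i
  simp [affineSet, ← this]

theorem isOpen_affineSet (i : Fin (n + 1)) : IsOpen (affineSet (n := n) i) := by
  rw [← isQuotientMap_mk'.isOpen_preimage]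
  have : (Projectivization.mk' ℂ ⁻¹' affineSet i : Set {v : Fin (n + 1) → ℂ // v ≠ 0}) =
      {v | v.1 i ≠ 0} := by
    ext ⟨v, hv⟩
    exact mk_mem_affineSet i v hv
  rw [this]
  exact isOpen_ne_fun ((continuous_apply i).comp continuous_subtype_val) continuous_const

theorem continuous_ofAffine (i : Fin (n + 1)) : Continuous (ofAffine (n := n) i) := by
  have h : Continuous (fun u : Fin n → ℂ =>
      (⟨(i.insertNth (1 : ℂ) u : Fin (n + 1) → ℂ), fun h => by simpa using congrFun h i⟩ :
        {v : Fin (n + 1) → ℂ // v ≠ 0})) := by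
    refine Continuous.subtype_mk ?_ _
    exact Continuous.finInsertNth i continuous_const continuous_id
  exact isQuotientMap_mk'.continuous.comp h

theorem continuousOn_affineCoord (i : Fin (n + 1)) :
    ContinuousOn (affineCoord (n := n) i) (affineSet i) := by
  rw [isQuotientMap_mk'.continuousOn_isOpen_iff (isOpen_affineSet i)]
  refine continuousOn_pi.2 fun j => ?_
  intro v hv
  have hv' : v.1 i ≠ 0 := (mk_mem_affineSet i v.1 v.2).1 hv
  have h1 : ContinuousAt (fun v : {v : Fin (n + 1) → ℂ // v ≠ 0} =>
      v.1 (i.succAbove j) / v.1 i) v :=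
    ContinuousAt.div ((continuous_apply _).comp continuous_subtype_val).continuousAt
      ((continuous_apply _).comp continuous_subtype_val).continuousAt hv'
  exact h1.continuousWithinAt

/-- The standard affine chart of `ℂℙⁿ` on the set where the `i`-th coordinate is nonzero. -/
def affineChart (i : Fin (n + 1)) : OpenPartialHomeomorph (CP n) (Fin n → ℂ) where
  toFun := affineCoord i
  invFun := ofAffine i
  source := affineSet i
  target := Set.univ
  map_source' _ _ := Set.mem_univ _
  map_target' u _ := by
    rw [ofAffine, mk_mem_affineSet]
    simp
  left_inv' p hp := by
    induction p using Projectivization.ind with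
    | h v hv =>
      have hvi : v i ≠ 0 := (mk_mem_affineSet i v hv).1 hp
      rw [ofAffine, Projectivization.mk_eq_mk_iff']
      refine ⟨(v i)⁻¹, ?_⟩
      funext j
      refine Fin.succAboveCases i ?_ (fun j => ?_) j
      · simp [hvi]
      · simp [affineCoord_mk, div_eq_inv_mul]
  right_inv' u _ := by
    funext j
    rw [ofAffine, affineCoord_mk]
    simp
  open_source := isOpen_affineSet i
  open_target := isOpen_univ
  continuousOn_toFun := continuousOn_affineCoord i
  continuousOn_invFun := (continuous_ofAffine i).continuousOn

theorem exists_mem_affineSet (p : CP n) : ∃ i, p ∈ affineSet i := by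
  by_contra! h
  exact p.rep_nonzero (funext fun i => by simpa [affineSet] using h i)

/-- `ℂℙⁿ` with its standard atlas of affine charts. -/
instance instChartedSpace : ChartedSpace (Fin n → ℂ) (CP n) where
  atlas := Set.range affineChart
  chartAt p := affineChart (exists_mem_affineSet p).choose
  mem_chart_source p := (exists_mem_affineSet p).choose_spec
  chart_mem_atlas _ := Set.mem_range_self _

/-- `ℂℙⁿ` is a complex (analytic) manifold. -/
instance instIsManifold : IsManifold 𝓘(ℂ, Fin n → ℂ) ω (CP n) := by
  refine isManifold_of_contDiffOn _ _ _ ?_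
  rintro _ _ ⟨i, rfl⟩ ⟨j, rfl⟩
  have hc : ∀ m : Fin (n + 1), ContDiff ℂ ω
      (fun u : Fin n → ℂ => (i.insertNth (1 : ℂ) u : Fin (n + 1) → ℂ) m) := by
    intro m
    refine Fin.succAboveCases i ?_ (fun m => ?_) m
    · simpa using contDiff_const
    · simpa using contDiff_apply ℂ ℂ m
  have key : ContDiffOn ℂ ω (fun u : Fin n → ℂ => affineCoord j (ofAffine i u))
      {u | (i.insertNth (1 : ℂ) u : Fin (n + 1) → ℂ) j ≠ 0} := by
    refine contDiffOn_pi.2 fun m => ?_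
    exact ContDiffOn.div (hc _).contDiffOn (hc _).contDiffOn fun u hu => hu
  refine key.mono ?_
  intro u hu
  have hu' := hu.1.2
  exact (mk_mem_affineSet j _ _).1 hu'

end CP

/-! ## Tori and their actions -/

/-- The torus `Tⁿ = (S¹)ⁿ`. -/
abbrev Torus (n : ℕ) : Type := Fin n → Circle

/-- The character `g ↦ g^w = g₁^{w₁} ⋯ gₙ^{wₙ}` of the torus. -/
def Torus.char {n : ℕ} (w : Fin n → ℤ) : Torus n →* Circle where
  toFun g := ∏ i, g i ^ w i
  map_one' := by simp
  map_mul' g h := by simp [mul_zpow, Finset.prod_mul_distrib]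

/-- The covering homomorphism `ℝⁿ → Tⁿ`, `θ ↦ (e^{iθ₁}, …, e^{iθₙ})`. -/
def Torus.exp {n : ℕ} (θ : Fin n → ℝ) : Torus n := fun i => Circle.exp (θ i)

/-- The set of points fixed by all elements of a subset `H` of the acting group. -/
def fixedSet {G M : Type*} [Group G] (ρ : G →* Equiv.Perm M) (H : Set G) : Set M :=
  {x | ∀ g ∈ H, ρ g x = x}

/-- The diagonal map `[z₀ : … : zₙ] ↦ [t₀ z₀ : … : tₙ zₙ]` of projective space. -/
def CP.diag {n : ℕ} (t : Fin (n + 1) → Circle) : CP n → CP n :=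
  Projectivization.map
    (LinearMap.pi fun i => (t i : ℂ) • LinearMap.proj (R := ℂ) (φ := fun _ => ℂ) i)
    (fun z w h => by
      funext i
      have hi := congrFun h i
      simpa using hi)

theorem CP.diag_mk_ne_zero {n : ℕ} (t : Fin (n + 1) → Circle) {z : Fin (n + 1) → ℂ}
    (hz : z ≠ 0) : (fun i => (t i : ℂ) * z i) ≠ 0 := by
  intro h
  apply hz
  funext i
  simpa using congrFun h i

theorem CP.diag_mk {n : ℕ} (t : Fin (n + 1) → Circle) (z : Fin (n + 1) → ℂ) (hz : z ≠ 0) :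
    CP.diag t (Projectivization.mk ℂ z hz) =
      Projectivization.mk ℂ (fun i => (t i : ℂ) * z i) (CP.diag_mk_ne_zero t hz) := rfl

theorem CP.diag_diag {n : ℕ} (s t : Fin (n + 1) → Circle) (p : CP n) :
    CP.diag s (CP.diag t p) = CP.diag (s * t) p := by
  induction p using Projectivization.ind with
  | h z hz => simp only [CP.diag_mk, Pi.mul_apply, Circle.coe_mul, mul_assoc]

theorem CP.diag_one {n : ℕ} (p : CP n) : CP.diag 1 p = p := by
  induction p using Projectivization.ind with
  | h z hz => simp [CP.diag_mk]

/-- The diagonal action on projective space through the characters `χ₀, …, χₙ`: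
`g · [z₀ : … : zₙ] = [g^{χ₀} z₀ : … : g^{χₙ} zₙ]`. -/
def CP.torusAction {r n : ℕ} (χ : Fin (n + 1) → Fin r → ℤ) : Torus r →* Equiv.Perm (CP n) where
  toFun g :=
    { toFun := CP.diag fun i => Torus.char (χ i) g
      invFun := CP.diag fun i => Torus.char (χ i) g⁻¹
      left_inv := fun p => by
        rw [CP.diag_diag]
        convert CP.diag_one p
        funext i
        simp
      right_inv := fun p => by
        rw [CP.diag_diag]
        convert CP.diag_one p
        funext i
        simp }
  map_one' := by
    ext p
    change CP.diag _ p = p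
    have h : (fun i => Torus.char (χ i) (1 : Torus r)) = 1 := by
      funext i
      simp
    rw [h, CP.diag_one]
  map_mul' g h := by
    ext p
    simp only [Equiv.coe_fn_mk, Equiv.Perm.coe_mul, Function.comp_apply, CP.diag_diag]
    congr 1
    funext i
    simp

/-- The product of two actions. -/
def prodAction {G X Y : Type*} [Group G] (σ : G →* Equiv.Perm X) (τ : G →* Equiv.Perm Y) :
    G →* Equiv.Perm (X × Y) where
  toFun g := (σ g).prodCongr (τ g)
  map_one' := by ext p <;> simp
  map_mul' g h := by ext p <;> simp

/-- The restriction of an action to an invariant subset. -/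
def restrictAction {G X : Type*} [Group G] (σ : G →* Equiv.Perm X) (S : Set X)
    (hS : ∀ g, ∀ x ∈ S, σ g x ∈ S) : G →* Equiv.Perm S where
  toFun g :=
    { toFun := fun x => ⟨σ g x.1, hS g x.1 x.2⟩
      invFun := fun x => ⟨σ g⁻¹ x.1, hS g⁻¹ x.1 x.2⟩
      left_inv := fun x => Subtype.ext (by simp)
      right_inv := fun x => Subtype.ext (by simp) }
  map_one' := by ext x; simp
  map_mul' g h := by ext x; simp

/-! ## Almost complex torus manifolds -/

section AlmostComplex

variable (E : Type*) [NormedAddCommGroup E] [NormedSpace ℝ E]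
  (M : Type*) [TopologicalSpace M] [ChartedSpace E M] [IsManifold 𝓘(ℝ, E) ∞ M]

/-- An almost complex structure on a smooth manifold: a smooth bundle endomorphism `J` of the
tangent bundle with `J² = -1`. -/
structure AlmostComplexStructure where
  /-- The endomorphism of each tangent space. -/
  J : ∀ x : M, TangentSpace 𝓘(ℝ, E) x →L[ℝ] TangentSpace 𝓘(ℝ, E) x
  sq_eq_neg : ∀ (x : M) (v : TangentSpace 𝓘(ℝ, E) x), J x (J x v) = -v
  smooth : ContMDiff 𝓘(ℝ, E).tangent 𝓘(ℝ, E).tangent ∞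
    (fun v : TangentBundle 𝓘(ℝ, E) M => (⟨v.1, J v.1 v.2⟩ : TangentBundle 𝓘(ℝ, E) M))

variable {E M}

/-- `M` with the almost complex structure `J` and the action `ρ` of `Tⁿ` is a `2n`-dimensional
almost complex torus manifold: compact, connected, with a smooth effective action of `Tⁿ` that
preserves `J` and has a fixed point. Smoothness of the action map `Tⁿ × M → M` is expressed on
`ℝⁿ × M`, through the smooth covering `ℝⁿ → Tⁿ`. -/
structure IsAlmostComplexTorusManifold (n : ℕ) (J : AlmostComplexStructure E M)
    (ρ : Torus n →* Equiv.Perm M) : Prop where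
  finiteDimensional : FiniteDimensional ℝ E
  finrank_eq : Module.finrank ℝ E = 2 * n
  t2 : T2Space M
  compact : CompactSpace M
  connected : ConnectedSpace M
  smooth_action : ContMDiff (𝓘(ℝ, Fin n → ℝ).prod 𝓘(ℝ, E)) 𝓘(ℝ, E) ∞
    (fun p : (Fin n → ℝ) × M => ρ (Torus.exp p.1) p.2)
  preserves_J : ∀ (g : Torus n) (x : M) (v : TangentSpace 𝓘(ℝ, E) x),
    mfderiv 𝓘(ℝ, E) 𝓘(ℝ, E) (ρ g) x (J.J x v) =
      J.J (ρ g x) (mfderiv 𝓘(ℝ, E) 𝓘(ℝ, E) (ρ g) x v)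
  effective : Function.Injective ρ
  exists_fixed : (fixedSet ρ Set.univ).Nonempty

/-- `W` is the multiset of weights of the action `ρ` at the isolated fixed point `p`: the complex
vector space `(T_pM, J_p)` has a basis `v₁, …, v_m` of vectors such that `g` acts on the complex
line of `v_i` as multiplication by `g^{w_i}`, with all `w_i ≠ 0` and `W = {w₁, …, w_m}`. -/
def IsWeightMultiset {n : ℕ} (J : AlmostComplexStructure E M) (ρ : Torus n →* Equiv.Perm M)
    (p : M) (W : Multiset (Fin n → ℤ)) : Prop :=
  ∃ (m : ℕ) (w : Fin m → Fin n → ℤ) (v : Fin m → TangentSpace 𝓘(ℝ, E) p),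
    LinearIndependent ℝ (Sum.elim v fun i => J.J p (v i)) ∧
    Submodule.span ℝ (Set.range (Sum.elim v fun i => J.J p (v i))) = ⊤ ∧
    (∀ (g : Torus n) (i : Fin m),
      (mfderiv 𝓘(ℝ, E) 𝓘(ℝ, E) (ρ g) p (v i) : E) =
        ((Torus.char (w i) g : ℂ).re • v i + (Torus.char (w i) g : ℂ).im • J.J p (v i) :
          TangentSpace 𝓘(ℝ, E) p)) ∧
    (∀ i, w i ≠ 0) ∧
    W = Finset.univ.val.map w

end AlmostComplex

/-! ## Labeled directed multigraphs -/

/-- A labeled directed `k`-multigraph with vertex set `Vert` and edge set `Edge`: the initial and the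
terminal vertex of each edge, and a label in `ℤᵏ` of each edge. -/
structure LabeledMultigraph (k : ℕ) (Vert Edge : Type) where
  i : Edge → Vert
  t : Edge → Vert
  label : Edge → Fin k → ℤ

section Describes

variable {E : Type*} [NormedAddCommGroup E] [NormedSpace ℝ E]
  {M : Type*} [TopologicalSpace M] [ChartedSpace E M] [IsManifold 𝓘(ℝ, E) ∞ M]

/-- The multigraph `Γ`, with its vertices placed at points of `M` by `pt`, describes `M`. The fixed
points are isolated, and
* `pt` identifies the vertex set with the fixed point set;
* the multiset of weights at a vertex consists of the labels of the outgoing edges and the negatives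
  of the labels of the incoming edges;
* the end points of an edge with label `w` lie in the same connected component of `M^{ker w}`. -/
structure DescribesVia {n : ℕ} {Vert Edge : Type} [DecidableEq Vert] [Fintype Edge]
    (Γ : LabeledMultigraph n Vert Edge)
    (J : AlmostComplexStructure E M) (ρ : Torus n →* Equiv.Perm M) (pt : Vert → M) : Prop where
  isolated : DiscreteTopology (fixedSet ρ Set.univ)
  injective : Function.Injective pt
  range_eq : Set.range pt = fixedSet ρ Set.univ
  weights : ∀ v : Vert, IsWeightMultiset J ρ (pt v)
    ((Finset.univ.filter fun e => Γ.i e = v).val.map Γ.label +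
      (Finset.univ.filter fun e => Γ.t e = v).val.map fun e => -Γ.label e)
  component : ∀ e : Edge, pt (Γ.t e) ∈
    connectedComponentIn (fixedSet ρ {g | Torus.char (Γ.label e) g = 1}) (pt (Γ.i e))

/-- `Γ` describes `M`, for some identification of its vertices with the fixed points. -/
def Describes {n : ℕ} {Vert Edge : Type} [DecidableEq Vert] [Fintype Edge]
    (Γ : LabeledMultigraph n Vert Edge)
    (J : AlmostComplexStructure E M) (ρ : Torus n →* Equiv.Perm M) : Prop :=
  ∃ pt : Vert → M, DescribesVia Γ J ρ pt

end Describes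

/-- The Euler number of `X` is `e`: `X` has a finite CW structure, and `e` is the alternating sum
of its numbers of cells. -/
def HasEulerNumber (X : Type) [TopologicalSpace X] (e : ℤ) : Prop :=
  ∃ C : CWComplex (Set.univ : Set X), CWComplex.Finite (Set.univ : Set X) ∧
    ∑ᶠ n : ℕ, (-1 : ℤ) ^ n * (Nat.card (C.cell n) : ℤ) = e

/-! ## The two graphs -/

/-- The graph of type (a); the vertex `pⱼ` is `j - 1 : Fin 6`. -/
def graphA (a b c : Fin 3 → ℤ) (k : ℤ) : LabeledMultigraph 3 (Fin 6) (Fin 9) where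
  i := ![1, 1, 0, 4, 4, 5, 0, 1, 2]
  t := ![0, 2, 2, 5, 3, 3, 5, 4, 3]
  label := ![a, a + b, b, a, a + b, b, c + k • a, c, c + k • (a + b)]

/-- The graph of type (b); the vertex `pⱼ` is `j - 1 : Fin 6`. -/
def graphB (a b c : Fin 3 → ℤ) (k l : ℤ) : LabeledMultigraph 3 (Fin 6) (Fin 9) where
  i := ![1, 1, 0, 4, 4, 5, 0, 1, 2]
  t := ![0, 2, 2, 5, 3, 3, 5, 4, 3]
  label := ![a, a + b, b, a + k • c, a + b + (k + l) • c, b + l • c, c, c, c]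

/-! ## The two families of manifolds -/

/-- `M₁(k) ⊂ ℂℙ³ × ℂℙ²` is given by `z_i w_j^k = z_j w_i^k` for `0 ≤ i < j ≤ 2`. -/
def M1 (k : ℕ) : Set (CP 3 × CP 2) :=
  {p | ∃ (z : Fin 4 → ℂ) (w : Fin 3 → ℂ) (hz : z ≠ 0) (hw : w ≠ 0),
    p = (Projectivization.mk ℂ z hz, Projectivization.mk ℂ w hw) ∧
    z 0 * w 1 ^ k = z 1 * w 0 ^ k ∧ z 1 * w 2 ^ k = z 2 * w 1 ^ k ∧
    z 0 * w 2 ^ k = z 2 * w 0 ^ k}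

/-- `M₂(k, l) ⊂ ℂℙ⁴ × ℂℙ¹`, for `k ≥ 0` and `k + l ≥ 0`, is given by `z₀ w₁^k = z₃ w₀^k` and
`z₂ w₁^{k+l} = z₄ w₀^{k+l}`. -/
def M2 (k : ℕ) (l : ℤ) : Set (CP 4 × CP 1) :=
  {p | ∃ (z : Fin 5 → ℂ) (w : Fin 2 → ℂ) (hz : z ≠ 0) (hw : w ≠ 0),
    p = (Projectivization.mk ℂ z hz, Projectivization.mk ℂ w hw) ∧
    z 0 * w 1 ^ k = z 3 * w 0 ^ k ∧
    z 2 * w 1 ^ (k + l).toNat = z 4 * w 0 ^ (k + l).toNat}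

theorem Torus.char_add {n : ℕ} (v w : Fin n → ℤ) (g : Torus n) :
    Torus.char (v + w) g = Torus.char v g * Torus.char w g := by
  simp [Torus.char, zpow_add, Finset.prod_mul_distrib]

theorem Torus.char_zero {n : ℕ} (g : Torus n) : Torus.char (0 : Fin n → ℤ) g = 1 := by
  simp [Torus.char]

theorem Torus.char_nsmul {n : ℕ} (k : ℕ) (w : Fin n → ℤ) (g : Torus n) :
    Torus.char (k • w) g = Torus.char w g ^ k := by
  induction k with
  | zero => simp [Torus.char_zero]
  | succ k ih => rw [succ_nsmul, Torus.char_add, ih, pow_succ]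

/-- The action of `T³` on `ℂℙ³ × ℂℙ²` by
`g · ([z₀ : z₁ : z₂ : z₃], [w₀ : w₁ : w₂]) =
  ([z₀ : g^{ka} z₁ : g^{k(a+b)} z₂ : g^{-c} z₃], [w₀ : g^a w₁ : g^{a+b} w₂])`. -/
def ambientAction1 (a b c : Fin 3 → ℤ) (k : ℕ) : Torus 3 →* Equiv.Perm (CP 3 × CP 2) :=
  prodAction (CP.torusAction ![0, k • a, k • (a + b), -c]) (CP.torusAction ![0, a, a + b])

theorem ambientAction1_mem (a b c : Fin 3 → ℤ) (k : ℕ) (g : Torus 3) :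
    ∀ p ∈ M1 k, ambientAction1 a b c k g p ∈ M1 k := by
  rintro _ ⟨z, w, hz, hw, rfl, h1, h2, h3⟩
  refine ⟨_, _, CP.diag_mk_ne_zero _ hz, CP.diag_mk_ne_zero _ hw, rfl, ?_, ?_, ?_⟩
  · simp [-nsmul_eq_mul, -zsmul_eq_mul, -smul_add, Torus.char_zero, Torus.char_nsmul, mul_pow]
    linear_combination (Torus.char a g : ℂ) ^ k * h1
  · simp [-nsmul_eq_mul, -zsmul_eq_mul, -smul_add, Torus.char_nsmul, mul_pow]
    linear_combination (Torus.char a g : ℂ) ^ k * (Torus.char (a + b) g : ℂ) ^ k * h2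
  · simp [-nsmul_eq_mul, -zsmul_eq_mul, -smul_add, Torus.char_zero, Torus.char_nsmul, mul_pow]
    linear_combination (Torus.char (a + b) g : ℂ) ^ k * h3

/-- The action of `T³` on `M₁(k)`, the restriction of `ambientAction1`. -/
def action1 (a b c : Fin 3 → ℤ) (k : ℕ) : Torus 3 →* Equiv.Perm (M1 k) :=
  restrictAction (ambientAction1 a b c k) (M1 k) (ambientAction1_mem a b c k)

/-- The action of `T³` on `ℂℙ⁴ × ℂℙ¹` by
`g · ([z₀ : z₁ : z₂ : z₃ : z₄], [w₀ : w₁]) =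
  ([z₀ : g^{-a} z₁ : g^b z₂ : g^{kc} z₃ : g^{b+(k+l)c} z₄], [w₀ : g^c w₁])`. -/
def ambientAction2 (a b c : Fin 3 → ℤ) (k : ℕ) (l : ℤ) :
    Torus 3 →* Equiv.Perm (CP 4 × CP 1) :=
  prodAction (CP.torusAction ![0, -a, b, k • c, b + (k + l) • c]) (CP.torusAction ![0, c])

theorem ambientAction2_mem (a b c : Fin 3 → ℤ) (k : ℕ) (l : ℤ) (hkl : 0 ≤ k + l) (g : Torus 3) :
    ∀ p ∈ M2 k l, ambientAction2 a b c k l g p ∈ M2 k l := by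
  obtain ⟨m, hm⟩ := Int.eq_ofNat_of_zero_le hkl
  rintro _ ⟨z, w, hz, hw, rfl, h1, h2⟩
  refine ⟨_, _, CP.diag_mk_ne_zero _ hz, CP.diag_mk_ne_zero _ hw, rfl, ?_, ?_⟩
  · simp [-nsmul_eq_mul, -zsmul_eq_mul, -smul_add, Torus.char_zero, Torus.char_nsmul, mul_pow]
    linear_combination (Torus.char c g : ℂ) ^ k * h1
  · rw [hm, Int.toNat_natCast] at h2
    rw [hm]
    simp [-nsmul_eq_mul, -zsmul_eq_mul, Torus.char_zero, Torus.char_add, Torus.char_nsmul,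
      natCast_zsmul, mul_pow]
    linear_combination (Torus.char b g : ℂ) * (Torus.char c g : ℂ) ^ m * h2

/-- The action of `T³` on `M₂(k, l)`, the restriction of `ambientAction2`. -/
def action2 (a b c : Fin 3 → ℤ) (k : ℕ) (l : ℤ) (hkl : 0 ≤ k + l) :
    Torus 3 →* Equiv.Perm (M2 k l) :=
  restrictAction (ambientAction2 a b c k l) (M2 k l) (ambientAction2_mem a b c k l hkl)

/-! ## The assertions -/

/-- `Γ` describes some 6-dimensional almost complex torus manifold with Euler number 6. -/
def DescribesSomeManifold {Vert Edge : Type} [DecidableEq Vert] [Fintype Edge]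
    (Γ : LabeledMultigraph 3 Vert Edge) : Prop :=
  ∃ (M : Type) (_ : TopologicalSpace M) (_ : ChartedSpace (Fin 3 → ℂ) M)
    (_ : IsManifold 𝓘(ℝ, Fin 3 → ℂ) ∞ M) (J : AlmostComplexStructure (Fin 3 → ℂ) M)
    (ρ : Torus 3 →* Equiv.Perm M),
    IsAlmostComplexTorusManifold 3 J ρ ∧ HasEulerNumber M 6 ∧ Describes Γ J ρ

/-- The subset `S` of `ℂℙᵐ × ℂℙⁿ` is a complex submanifold of complex dimension 3; with the
almost complex structure given by its complex structure (multiplication by `i` on the tangent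
spaces) and with the action `ρ`, it is a 6-dimensional almost complex torus manifold with Euler
number 6 that is described by `Γ`. -/
def SubmanifoldDescribedBy {m n : ℕ} (S : Set (CP m × CP n)) (ρ : Torus 3 →* Equiv.Perm S)
    {Vert Edge : Type} [DecidableEq Vert] [Fintype Edge]
    (Γ : LabeledMultigraph 3 Vert Edge) : Prop :=
  ∃ (_ : ChartedSpace (Fin 3 → ℂ) S) (_ : IsManifold 𝓘(ℂ, Fin 3 → ℂ) ω S)
    (_ : IsManifold 𝓘(ℝ, Fin 3 → ℂ) ∞ S) (J : AlmostComplexStructure (Fin 3 → ℂ) S),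
    Manifold.IsSmoothEmbedding 𝓘(ℂ, Fin 3 → ℂ) (𝓘(ℂ, Fin m → ℂ).prod 𝓘(ℂ, Fin n → ℂ)) ω
      (Subtype.val : S → CP m × CP n) ∧
    (∀ (x : S) (v : Fin 3 → ℂ), (J.J x v : Fin 3 → ℂ) = Complex.I • v) ∧
    IsAlmostComplexTorusManifold 3 J ρ ∧ HasEulerNumber S 6 ∧ Describes Γ J ρ

end

/-! All the manifolds are projectivized sums of line bundles over a projective space. For degrees
`d₀, …, d_q ≥ 0`, consider pairs `(w, s)` of nonzero vectors in `ℂᵖ⁺¹` and `ℂ^(q+1)`, and identify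
`(w, s_j)` with `(t w, u t^{-d_j} s_j)`. The monomials `s_j w_i^{d_j}` together with `[w]` embed the
quotient in a product of projective spaces; this image is `SplitBundle.carrier`. The defining
equations of `M1` and `M2` say that certain coordinates are proportional to powers of the `w_i`, so
these sets are the cases `p = 2, q = 1` with degrees `k, 0` and `p = 1, q = 2` with degrees `k, 0, k
+ l` (`M1_eq_carrier`, `M2_eq_carrier`).

The torus scales `w_i` by a character `χ_i` and `s_j` by `φ_j`, hence the monomial `s_j w_i^{d_j}`
by `φ_j + d_j χ_i`, the `lineWeight`. The charts `w_i ≠ 0, s_j ≠ 0` are invariant copies of `ℂʳ`. On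
each the action is linear and diagonal, with the differences of these characters as weights
(`coords_action`, `chart_action`). Smoothness, invariance of the complex structure, effectiveness,
the fixed points (one origin per chart) and the weights at them can all be read off. Letting two
entries of `w`, or two of `s`, vary gives a projective line joining two fixed points and fixed by
the kernel of the corresponding character; these lines are the edges (`fixedPt_mem_component_base`,
`fixedPt_mem_component_fiber`).

Products of the standard cells of the base and of the fibre give `(p + 1)(q + 1) = 6` cells, all of
even dimension (`hasEulerNumber_of_cells`, `hasEulerNumber`). The inclusion is an embedding because
in a chart it is a polynomial map with a linear left inverse (`isSmoothEmbedding_val`).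

The weights depend on the degrees only through their differences (`lineWeight_sub`). Every pair of
integers `k, l` is therefore realized by nonnegative degrees, using the embedding by all the
monomials. -/

noncomputable section

/-! ## Complex manifolds as almost complex manifolds -/

section ComplexManifold

variable {E : Type*} [NormedAddCommGroup E] [NormedSpace ℂ E]
  {M : Type*} [TopologicalSpace M] [ChartedSpace E M]

/-- A complex manifold is a smooth real manifold. -/
theorem IsManifold.real_of_complex [NormedSpace ℝ E] [IsScalarTower ℝ ℂ E]
    [h : IsManifold 𝓘(ℂ, E) ω M] : IsManifold 𝓘(ℝ, E) ∞ M := by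
  refine isManifold_of_contDiffOn _ _ _ fun e e' he he' => ?_
  have := (contDiffGroupoid ω 𝓘(ℂ, E)).compatible he he'
  rw [contDiffGroupoid, mem_groupoid_of_pregroupoid] at this
  replace this := this.1
  simp only [contDiffPregroupoid] at this
  simp only [modelWithCornersSelf_coe, modelWithCornersSelf_coe_symm, Function.id_comp,
    Function.comp_id, Set.preimage_id, Set.range_id, Set.inter_univ] at this ⊢
  exact (this.restrict_scalars ℝ).of_le le_top

variable [NormedSpace ℝ E] [IsScalarTower ℝ ℂ E] [IsManifold 𝓘(ℂ, E) ω M]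
  [IsManifold 𝓘(ℝ, E) ∞ M]

/-- The tangent coordinate changes of a complex manifold commute with multiplication by `i`. -/
theorem tangentCoordChange_I_smul {x y z : M} (hx : z ∈ (chartAt E x).source)
    (hy : z ∈ (chartAt E y).source) (v : E) :
    tangentCoordChange 𝓘(ℝ, E) x y z (Complex.I • v) =
      Complex.I • tangentCoordChange 𝓘(ℝ, E) x y z v := by
  have : IsManifold 𝓘(ℝ, E) 1 M := IsManifold.of_le (n := ∞) (by simp)
  have : IsManifold 𝓘(ℂ, E) 1 M := IsManifold.of_le (n := ω) (by simp)
  have h1 := hasFDerivWithinAt_tangentCoordChange (I := 𝓘(ℝ, E)) (x := x) (y := y) (z := z)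
    (by simpa using ⟨hx, hy⟩)
  have h2 := hasFDerivWithinAt_tangentCoordChange (I := 𝓘(ℂ, E)) (x := x) (y := y) (z := z)
    (by simpa using ⟨hx, hy⟩)
  simp only [mfld_simps, hasFDerivWithinAt_univ] at h1 h2
  -- The real derivative is the complex one with scalars restricted, hence complex linear.
  rw [h1.unique (h2.restrictScalars ℝ)]
  simp

/-- The almost complex structure of a complex manifold, multiplication by `i` on the tangent
spaces. -/
def complexStructure : AlmostComplexStructure E M where
  J _ := (Complex.I • ContinuousLinearMap.id ℂ E).restrictScalars ℝ
  sq_eq_neg _ (v : E) := by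
    change Complex.I • Complex.I • v = -v
    rw [smul_smul, Complex.I_mul_I, neg_one_smul]
  smooth := by
    intro v₀
    rw [Bundle.contMDiffAt_totalSpace]
    refine ⟨(Bundle.contMDiff_proj (IB := 𝓘(ℝ, E)) (TangentSpace 𝓘(ℝ, E))).contMDiffAt, ?_⟩
    have h0 : ContMDiffAt 𝓘(ℝ, E).tangent 𝓘(ℝ, E) ∞
        (fun v : TangentBundle 𝓘(ℝ, E) M => (trivializationAt E (TangentSpace 𝓘(ℝ, E)) v₀.1 v).2)
        v₀ :=
      (Bundle.contMDiffAt_totalSpace.1 (contMDiffAt_id (x := v₀) (n := ∞)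
        (I := 𝓘(ℝ, E).tangent))).2
    have h1 : ContMDiff 𝓘(ℝ, E) 𝓘(ℝ, E) ∞ (fun u : E => Complex.I • u) :=
      ((Complex.I • ContinuousLinearMap.id ℂ E).restrictScalars ℝ).contDiff.contMDiff
    -- Because coordinate changes are complex linear, `J` in the trivialization around `v₀` is the
    -- constant map `u ↦ i u`.
    refine (h1.contMDiffAt.comp v₀ h0).congr_of_eventuallyEq ?_
    have hs : (Bundle.TotalSpace.proj ⁻¹' (chartAt E v₀.1).source :
        Set (TangentBundle 𝓘(ℝ, E) M)) ∈ 𝓝 v₀ :=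
      (FiberBundle.continuous_proj E (TangentSpace 𝓘(ℝ, E))).continuousAt
        ((chartAt E v₀.1).open_source.mem_nhds (mem_chart_source E v₀.1))
    filter_upwards [hs] with v hv
    exact tangentCoordChange_I_smul (mem_chart_source E v.1) hv v.2

theorem complexStructure_apply (x : M) (v : E) :
    ((complexStructure (E := E) (M := M)).J x v : E) = Complex.I • v := rfl

end ComplexManifold

/-! ## Immersions with a linear left inverse in charts -/

/-- Needed to use a straightened product chart, which is not in the atlas itself, as a chart of the
target of an immersion. -/
theorem StructureGroupoid.trans_mem_maximalAtlas {H M : Type*} [TopologicalSpace H]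
    [TopologicalSpace M] [ChartedSpace H M] {G : StructureGroupoid H}
    {e : OpenPartialHomeomorph M H} (he : e ∈ G.maximalAtlas M)
    {f : OpenPartialHomeomorph H H} (hf : f ∈ G) : e.trans f ∈ G.maximalAtlas M := by
  rw [mem_maximalAtlas_iff] at he ⊢
  intro e' he'
  obtain ⟨h1, h2⟩ := he e' he'
  refine ⟨?_, ?_⟩
  · rw [OpenPartialHomeomorph.trans_symm_eq_symm_trans_symm, OpenPartialHomeomorph.trans_assoc]
    exact G.trans (G.symm hf) h1
  · rw [← OpenPartialHomeomorph.trans_assoc]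
    exact G.trans h2 hf

section Immersion

variable {𝕜 : Type*} [NontriviallyNormedField 𝕜]
  {E V : Type*} [NormedAddCommGroup E] [NormedSpace 𝕜 E] [NormedAddCommGroup V] [NormedSpace 𝕜 V]

/-- The homeomorphism of `V` that carries a graph-like parametrized subspace `h(E)`, where `h` has
the linear left inverse `π`, to the linear subspace `ι(E)`. -/
def straighten (h : E → V) (hc : Continuous h) (π : V →L[𝕜] E) (ι : E →L[𝕜] V)
    (hh : ∀ y, π (h y) = y) (hι : ∀ y, π (ι y) = y) : V ≃ₜ V where
  toFun y := y - h (π y) + ι (π y)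
  invFun y := y + h (π y) - ι (π y)
  left_inv y := by
    simp only [map_add, map_sub, hh, hι, sub_self, zero_add]
    abel
  right_inv y := by
    simp only [map_add, map_sub, hh, hι, add_sub_cancel_right]
    abel
  continuous_toFun := by fun_prop
  continuous_invFun := by fun_prop

variable {E₁ E₂ F : Type*} [NormedAddCommGroup E₁] [NormedSpace 𝕜 E₁]
  [NormedAddCommGroup E₂] [NormedSpace 𝕜 E₂] [NormedAddCommGroup F] [NormedSpace 𝕜 F]
  {M : Type*} [TopologicalSpace M] [ChartedSpace E M]
  {N₁ : Type*} [TopologicalSpace N₁] [ChartedSpace E₁ N₁] [IsManifold 𝓘(𝕜, E₁) ω N₁]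
  {N₂ : Type*} [TopologicalSpace N₂] [ChartedSpace E₂ N₂] [IsManifold 𝓘(𝕜, E₂) ω N₂]

/-- A map that in charts has a linear left inverse is an immersion. -/
theorem isImmersionAtOfComplement_of_leftInverse {f : M → N₁ × N₂} {x : M}
    {φ : OpenPartialHomeomorph M E} (hφ : φ ∈ IsManifold.maximalAtlas 𝓘(𝕜, E) ω M)
    {ψ₁ : OpenPartialHomeomorph N₁ E₁} (hψ₁ : ψ₁ ∈ atlas E₁ N₁)
    {ψ₂ : OpenPartialHomeomorph N₂ E₂} (hψ₂ : ψ₂ ∈ atlas E₂ N₂)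
    (hx : x ∈ φ.source) (hs : ∀ x ∈ φ.source, (f x).1 ∈ ψ₁.source ∧ (f x).2 ∈ ψ₂.source)
    (h : E → E₁ × E₂) (hd : ContDiff 𝕜 ω h) (π : E₁ × E₂ →L[𝕜] E) (ι : E →L[𝕜] E₁ × E₂)
    (hh : ∀ y, π (h y) = y) (hι : ∀ y, π (ι y) = y)
    (hfh : ∀ y ∈ φ.target, (ψ₁ (f (φ.symm y)).1, ψ₂ (f (φ.symm y)).2) = h y)
    (eF : F ≃L[𝕜] π.ker) :
    Manifold.IsImmersionAtOfComplement F 𝓘(𝕜, E) (𝓘(𝕜, E₁).prod 𝓘(𝕜, E₂)) ω f x := by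
  -- `Ψ` keeps the part `y - h (π y)`, which lies in the kernel of `π`, and replaces `h (π y)` by `ι
  -- (π y)`. It thus turns `h` into the linear injection `ι`, with complement `π.ker`.
  let Ψ : E₁ × E₂ ≃ₜ E₁ × E₂ := straighten h hd.continuous π ι hh hι
  let equiv : (E × F) ≃L[𝕜] E₁ × E₂ :=
    ((ContinuousLinearEquiv.refl 𝕜 E).prodCongr eF).trans
      (ContinuousLinearEquiv.equivOfRightInverse π ι hι).symm
  let G := contDiffGroupoid ω (𝓘(𝕜, E₁).prod 𝓘(𝕜, E₂))
  have hΨ : (Ψ.toOpenPartialHomeomorph : OpenPartialHomeomorph (ModelProd E₁ E₂) (ModelProd E₁ E₂))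
      ∈ G := by
    refine mem_groupoid_of_pregroupoid.2 ⟨?_, ?_⟩
    · change ContDiffOn 𝕜 ω (fun y : E₁ × E₂ => y - h (π y) + ι (π y)) _
      exact ((contDiff_id.sub (hd.comp π.contDiff)).add (ι.contDiff.comp π.contDiff)).contDiffOn
    · change ContDiffOn 𝕜 ω (fun y : E₁ × E₂ => y + h (π y) - ι (π y)) _
      exact ((contDiff_id.add (hd.comp π.contDiff)).sub (ι.contDiff.comp π.contDiff)).contDiffOn
  refine Manifold.IsImmersionAtOfComplement.mk_of_charts equiv φ
    ((ψ₁.prod ψ₂).trans Ψ.toOpenPartialHomeomorph) hx ?_ hφ ?_ ?_ ?_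
  · simpa using hs x hx
  · refine StructureGroupoid.trans_mem_maximalAtlas ?_ hΨ
    exact G.subset_maximalAtlas ⟨ψ₁, hψ₁, ψ₂, hψ₂, rfl⟩
  · intro y hy
    simpa using hs y hy
  · intro y hy
    have hy' : y ∈ φ.target := by simpa using hy
    change Ψ (ψ₁ (f (φ.symm y)).1, ψ₂ (f (φ.symm y)).2) = ι y + ((eF 0 : π.ker) : E₁ × E₂)
    rw [hfh y hy']
    simp [Ψ, straighten, hh]

end Immersion

/-! ## More on complex projective space -/

namespace CP

variable {n : ℕ}

/-- The quotient `z_a / z_b` of two homogeneous coordinates. -/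
def ratio (a b : Fin (n + 1)) (p : CP n) : ℂ := p.rep a / p.rep b

theorem ratio_mk (a b : Fin (n + 1)) (v : Fin (n + 1) → ℂ) (hv : v ≠ 0) :
    ratio a b (Projectivization.mk ℂ v hv) = v a / v b := by
  obtain ⟨t, ht⟩ := Projectivization.exists_smul_eq_mk_rep ℂ v hv
  rw [ratio, ← ht]
  exact mul_div_mul_left _ _ t.ne_zero

theorem continuousOn_ratio (a b : Fin (n + 1)) :
    ContinuousOn (ratio (n := n) a b) (affineSet b) := by
  rw [isQuotientMap_mk'.continuousOn_isOpen_iff (isOpen_affineSet b)]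
  intro v hv
  have hv' : v.1 b ≠ 0 := (mk_mem_affineSet b v.1 v.2).1 hv
  have h1 : ContinuousAt (fun v : {v : Fin (n + 1) → ℂ // v ≠ 0} => v.1 a / v.1 b) v :=
    ContinuousAt.div ((continuous_apply _).comp continuous_subtype_val).continuousAt
      ((continuous_apply _).comp continuous_subtype_val).continuousAt hv'
  refine h1.continuousWithinAt.congr (fun w _ => ?_) ?_ <;> exact ratio_mk _ _ _ _

/-- The entry `z_a conj(z_b) / ∑ |z_c|²` of the orthogonal projection to a line. -/
def projEntry (a b : Fin (n + 1)) (p : CP n) : ℂ :=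
  p.rep a * starRingEnd ℂ (p.rep b) / ∑ c, p.rep c * starRingEnd ℂ (p.rep c)

theorem sum_mul_conj_ne_zero {v : Fin (n + 1) → ℂ} (hv : v ≠ 0) :
    ∑ c, v c * starRingEnd ℂ (v c) ≠ 0 := by
  obtain ⟨i, hi⟩ := Function.ne_iff.1 hv
  simp only [Complex.mul_conj]
  rw [← Complex.ofReal_sum, Complex.ofReal_ne_zero]
  refine (Finset.sum_pos' (fun c _ => Complex.normSq_nonneg _) ⟨i, Finset.mem_univ i, ?_⟩).ne'
  exact Complex.normSq_pos.2 hi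

theorem projEntry_mk (a b : Fin (n + 1)) (v : Fin (n + 1) → ℂ) (hv : v ≠ 0) :
    projEntry a b (Projectivization.mk ℂ v hv) =
      v a * starRingEnd ℂ (v b) / ∑ c, v c * starRingEnd ℂ (v c) := by
  obtain ⟨t, ht⟩ := Projectivization.exists_smul_eq_mk_rep ℂ v hv
  have ht' : (t.1 * starRingEnd ℂ t.1) ≠ 0 := mul_ne_zero t.ne_zero (by simp)
  rw [projEntry, ← ht]
  simp only [Units.smul_def, Pi.smul_apply, smul_eq_mul, map_mul]
  rw [← mul_div_mul_left (v a * _) _ ht', Finset.mul_sum]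
  congr 1
  · ring
  · exact Finset.sum_congr rfl fun c _ => by ring

theorem continuous_projEntry (a b : Fin (n + 1)) : Continuous (projEntry (n := n) a b) := by
  rw [isQuotientMap_mk'.continuous_iff]
  have hc : ∀ a b : Fin (n + 1), Continuous fun v : {v : Fin (n + 1) → ℂ // v ≠ 0} =>
      v.1 a * starRingEnd ℂ (v.1 b) := fun a b =>
    ((continuous_apply a).comp continuous_subtype_val).mul
      (Complex.continuous_conj.comp ((continuous_apply b).comp continuous_subtype_val))
  have h : Continuous fun v : {v : Fin (n + 1) → ℂ // v ≠ 0} =>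
      v.1 a * starRingEnd ℂ (v.1 b) / ∑ c, v.1 c * starRingEnd ℂ (v.1 c) :=
    Continuous.div (hc a b) (continuous_finsetSum _ fun c _ => hc c c) fun v =>
      sum_mul_conj_ne_zero v.2
  exact h.congr fun v => (projEntry_mk _ _ _ v.2).symm

/-- The matrix of the orthogonal projection to a line depends continuously on the line and
determines it: a nonzero column spans the line. -/
instance instT2Space : T2Space (CP n) := by
  refine T2Space.of_injective_continuous (f := fun (p : CP n) (ab : Fin (n + 1) × Fin (n + 1)) =>
    projEntry ab.1 ab.2 p) (fun p p' h => ?_) (continuous_pi fun _ => continuous_projEntry _ _)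
  induction p using Projectivization.ind with
  | h v hv =>
  induction p' using Projectivization.ind with
  | h v' hv' =>
  obtain ⟨b, hb⟩ := Function.ne_iff.1 hv
  have hb' : starRingEnd ℂ (v b) ≠ 0 := by simpa using hb
  have h2 := fun a => congrFun h (a, b)
  simp only [projEntry_mk] at h2
  have hs := sum_mul_conj_ne_zero hv
  have hs' := sum_mul_conj_ne_zero hv'
  rw [Projectivization.mk_eq_mk_iff']
  -- The factor solves the equality of the `(a, b)` entries for `v a`, with `b` a column where `v b
  -- ≠ 0`.
  refine ⟨(starRingEnd ℂ (v' b) / ∑ c, v' c * starRingEnd ℂ (v' c)) *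
    (∑ c, v c * starRingEnd ℂ (v c)) / starRingEnd ℂ (v b), funext fun a => ?_⟩
  have h3 := h2 a
  rw [div_eq_div_iff hs hs'] at h3
  simp only [Pi.smul_apply, smul_eq_mul]
  rw [div_mul_eq_mul_div, div_eq_iff hb', div_mul_eq_mul_div, div_mul_eq_mul_div, div_eq_iff hs']
  linear_combination -h3

end CP

/-! ## Finite CW structures on Hausdorff spaces -/

section CW

open Metric

variable {X : Type} [TopologicalSpace X] [T2Space X]

/-- Precomposition with a bijection of the index sets preserves the sup norm. -/
theorem norm_comp_equiv {α β : Type*} [Fintype α] [Fintype β] (e : α ≃ β) (x : β → ℝ) :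
    ‖x ∘ e‖ = ‖x‖ := by
  refine le_antisymm ?_ ?_
  · exact (pi_norm_le_iff_of_nonneg (norm_nonneg _)).2 fun a => norm_le_pi_norm x (e a)
  · refine (pi_norm_le_iff_of_nonneg (norm_nonneg _)).2 fun b => ?_
    simpa using norm_le_pi_norm (x ∘ e) (e.symm b)

/-- A map on the closed unit ball of a finite-dimensional space to a Hausdorff space that is
injective on the open ball, and for which no boundary point has the same image as an interior point,
restricts to a homeomorphism of the open ball onto its image. -/
theorem continuousOn_invFunOn_ball {V : Type*} [NormedAddCommGroup V] [ProperSpace V]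
    {φ : V → X} (hc : ContinuousOn φ (closedBall 0 1)) (hi : Set.InjOn φ (ball 0 1))
    (hb : ∀ x ∈ sphere (0 : V) 1, ∀ y ∈ ball (0 : V) 1, φ x ≠ φ y) :
    ContinuousOn (Function.invFunOn φ (ball 0 1)) (φ '' ball 0 1) := by
  rw [continuousOn_iff_isClosed]
  intro t ht
  -- This image is compact, hence closed in a Hausdorff space. It meets the open cell only in images
  -- of points of `t` in the open ball, since boundary points have other images.
  refine ⟨φ '' (t ∩ closedBall 0 1), ?_, ?_⟩
  · refine IsCompact.isClosed (IsCompact.image_of_continuousOn ?_ (hc.mono Set.inter_subset_right))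
    exact (isCompact_closedBall 0 1).inter_left ht
  · ext p
    constructor
    · rintro ⟨hp, y, hy, rfl⟩
      rw [Set.mem_preimage, hi.leftInvOn_invFunOn hy] at hp
      exact ⟨⟨y, ⟨hp, ball_subset_closedBall hy⟩, rfl⟩, y, hy, rfl⟩
    · rintro ⟨⟨x, ⟨hxt, hx⟩, hxy⟩, y, hy, rfl⟩
      refine ⟨?_, y, hy, rfl⟩
      rw [Set.mem_preimage, hi.leftInvOn_invFunOn hy]
      rw [← sphere_union_ball] at hx
      rcases hx with hx | hx
      · exact absurd hxy (hb x hx y hy)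
      · rwa [← hi hx hy hxy]

/-- A Hausdorff space that is the disjoint union of finitely many open cells, the boundary of each
of which lies in the union of those of lower dimension, has a finite CW structure with these
cells. -/
theorem hasEulerNumber_of_cells {ι : Type} [Fintype ι] (κ : ι → Type) [∀ i, Fintype (κ i)]
    (φ : ∀ i, (κ i → ℝ) → X) (hc : ∀ i, ContinuousOn (φ i) (closedBall 0 1))
    (hinj : ∀ i, Set.InjOn (φ i) (ball 0 1))
    (hdisj : ∀ i i', ∀ x ∈ ball (0 : κ i → ℝ) 1, ∀ x' ∈ ball (0 : κ i' → ℝ) 1,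
      φ i x = φ i' x' → i = i')
    (hsurj : ∀ p, ∃ i, ∃ x ∈ ball (0 : κ i → ℝ) 1, φ i x = p)
    (hbd : ∀ i, ∀ x ∈ sphere (0 : κ i → ℝ) 1, ∃ i', Fintype.card (κ i') < Fintype.card (κ i) ∧
      ∃ x' ∈ ball (0 : κ i' → ℝ) 1, φ i' x' = φ i x) :
    HasEulerNumber X (∑ i, (-1 : ℤ) ^ Fintype.card (κ i)) := by
  classical
  -- Cells are sorted by the number of their coordinates and reindexed by `Fin n`; the sup norm, and
  -- so the unit ball, does not notice the reindexing.
  let cell : ℕ → Type := fun n => {i : ι // Fintype.card (κ i) = n}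
  let e : ∀ n (i : cell n), κ i.1 ≃ Fin n := fun n i => Fintype.equivFinOfCardEq i.2
  let f : ∀ n (i : cell n), (Fin n → ℝ) → X := fun n i x => φ i.1 (x ∘ e n i)
  have hnorm : ∀ n (i : cell n) (x : Fin n → ℝ), ‖x ∘ e n i‖ = ‖x‖ := fun n i x =>
    norm_comp_equiv _ _
  have hfc : ∀ n i, ContinuousOn (f n i) (closedBall 0 1) := fun n i =>
    (hc i.1).comp (by fun_prop) fun x hx => by
      simpa [hnorm] using hx
  have hfi : ∀ n i, Set.InjOn (f n i) (ball 0 1) := by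
    intro n i x hx y hy h
    have := hinj i.1 (by simpa [hnorm] using hx) (by simpa [hnorm] using hy) h
    exact (e n i).surjective.injective_comp_right this
  have himage : ∀ n (i : cell n), ∀ x ∈ ball (0 : κ i.1 → ℝ) 1,
      φ i.1 x ∈ f n i '' ball 0 1 := by
    intro n i x hx
    have hx' : (x ∘ (e n i).symm) ∘ e n i = x := by funext; simp
    refine ⟨x ∘ (e n i).symm, ?_, by simp only [f, hx']⟩
    rw [mem_ball_zero_iff, ← hnorm n i, hx']
    simpa using hx
  have hfb : ∀ n i, ∀ x ∈ sphere (0 : Fin n → ℝ) 1, ∃ m, m < n ∧ ∃ j : cell m,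
      f n i x ∈ f m j '' ball 0 1 := by
    intro n i x hx
    obtain ⟨i', hlt, x', hx', h⟩ := hbd i.1 (x ∘ e n i) (by simpa [hnorm] using hx)
    refine ⟨_, hlt.trans_eq i.2, ⟨i', rfl⟩, ?_⟩
    simp only [f]
    rw [← h]
    exact himage _ ⟨i', rfl⟩ x' hx'
  have hfd : ∀ n m (i : cell n) (j : cell m), ∀ x ∈ ball (0 : Fin n → ℝ) 1,
      ∀ y ∈ ball (0 : Fin m → ℝ) 1, f n i x = f m j y → i.1 = j.1 := by
    intro n m i j x hx y hy h
    exact hdisj _ _ _ (by simpa [hnorm] using hx) _ (by simpa [hnorm] using hy) h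
  have hbne : ∀ n i, ∀ x ∈ sphere (0 : Fin n → ℝ) 1, ∀ y ∈ ball (0 : Fin n → ℝ) 1,
      f n i x ≠ f n i y := by
    intro n i x hx y hy h
    obtain ⟨m, hm, j, z, hz, hzx⟩ := hfb n i x hx
    -- A common value would lie in a cell of lower dimension and in the cell `i`. Disjointness makes
    -- these equal, against their dimensions.
    have := hfd n m i j y hy z hz (by rw [hzx, h])
    have h1 := i.2
    have h2 := j.2
    rw [this] at h1
    omega
  have hcover : ⋃ (n : ℕ) (j : cell n), f n j '' closedBall 0 1 = Set.univ := by
    refine Set.eq_univ_of_forall fun p => ?_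
    obtain ⟨i, x, hx, rfl⟩ := hsurj p
    refine Set.mem_iUnion₂.2 ⟨_, ⟨i, rfl⟩, ?_⟩
    exact Set.image_mono ball_subset_closedBall (himage _ ⟨i, rfl⟩ x hx)
  let map : ∀ n (i : cell n), PartialEquiv (Fin n → ℝ) X := fun n i =>
    (hfi n i).bijOn_image.toPartialEquiv _ _ _
  let C : CWComplex (Set.univ : Set X) :=
    { cell := cell
      map := map
      source_eq := fun _ _ => rfl
      continuousOn := hfc
      continuousOn_symm := fun n i => continuousOn_invFunOn_ball (hfc n i) (hfi n i) (hbne n i)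
      pairwiseDisjoint' := by
        rintro ⟨n, i⟩ - ⟨m, j⟩ - hne
        refine Set.disjoint_left.2 ?_
        rintro _ ⟨x, hx, rfl⟩ ⟨y, hy, h⟩
        apply hne
        have hij : i.1 = j.1 := hfd n m i j x hx y hy h.symm
        obtain ⟨i, rfl⟩ := i
        obtain ⟨j, rfl⟩ := j
        simp only at hij
        subst hij
        rfl
      mapsTo' := by
        intro n i
        refine ⟨fun m => Finset.univ, fun x hx => ?_⟩
        obtain ⟨m, hm, j, h⟩ := hfb n i x hx
        simp only [Set.mem_iUnion]
        exact ⟨m, hm, j, Finset.mem_univ _, Set.image_mono ball_subset_closedBall h⟩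
      closed' := by
        intro A _ hA
        -- With finitely many cells the weak topology condition is automatic: `A` is a finite union
        -- of its traces on the closed cells.
        have hA' : A = ⋃ i : ι, A ∩ f _ ⟨i, rfl⟩ '' closedBall 0 1 := by
          rw [← Set.inter_iUnion]
          refine (Set.inter_eq_left.2 fun p _ => ?_).symm
          have hp : p ∈ ⋃ (n : ℕ) (j : cell n), f n j '' closedBall 0 1 := hcover ▸ Set.mem_univ p
          obtain ⟨n, ⟨i, rfl⟩, h⟩ := Set.mem_iUnion₂.1 hp
          exact Set.mem_iUnion.2 ⟨i, h⟩
        rw [hA']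
        exact isClosed_iUnion_of_finite fun i => hA _ ⟨i, rfl⟩
      union' := hcover }
  refine ⟨C, ?_, ?_⟩
  · refine { eventually_isEmpty_cell := ?_, finite_cell := fun n => ?_ }
    · filter_upwards [Filter.eventually_gt_atTop (∑ i, Fintype.card (κ i))] with n hn
      refine ⟨fun i : cell n => ?_⟩
      have := Finset.single_le_sum (f := fun i => Fintype.card (κ i)) (fun _ _ => Nat.zero_le _)
        (Finset.mem_univ i.1)
      have h2 := i.2
      omega
    · exact (inferInstance : Finite (cell n))
  · change ∑ᶠ n : ℕ, (-1 : ℤ) ^ n * (Nat.card (cell n) : ℤ) = _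
    -- Only dimensions that occur contribute; the sum over cells is then grouped by dimension.
    rw [finsum_eq_sum_of_support_subset (s := Finset.univ.image fun i => Fintype.card (κ i))]
    · rw [← Finset.sum_fiberwise_of_maps_to (g := fun i => Fintype.card (κ i))
        (t := Finset.univ.image fun i => Fintype.card (κ i))
        (fun i _ => Finset.mem_image_of_mem _ (Finset.mem_univ i))]
      refine Finset.sum_congr rfl fun n _ => ?_
      rw [Finset.sum_congr rfl (g := fun _ => (-1 : ℤ) ^ n) (fun i hi => by
        rw [(Finset.mem_filter.1 hi).2])]
      rw [Finset.sum_const, nsmul_eq_mul, mul_comm, Nat.card_eq_fintype_card, Fintype.card_subtype]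
    · intro n hn
      have hn' : Nat.card (cell n) ≠ 0 := fun h => hn (by
        change (-1 : ℤ) ^ n * (Nat.card (cell n) : ℤ) = 0
        rw [h]
        simp)
      obtain ⟨i⟩ := (Nat.card_ne_zero.1 hn').1
      simpa using ⟨i.1, i.2⟩

end CW

/-! ## Vectors with a coordinate equal to one -/

/-- The vector `u` with an entry `1` inserted at `i`. -/
def insertOne {n : ℕ} (i : Fin (n + 1)) (u : Fin n → ℂ) : Fin (n + 1) → ℂ := i.insertNth (1 : ℂ) u

@[simp] theorem insertOne_same {n : ℕ} (i : Fin (n + 1)) (u : Fin n → ℂ) : insertOne i u i = 1 := by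
  simp [insertOne]

@[simp] theorem insertOne_succAbove {n : ℕ} (i : Fin (n + 1)) (u : Fin n → ℂ) (a : Fin n) :
    insertOne i u (i.succAbove a) = u a := by
  simp [insertOne]

theorem insertOne_ne_zero {n : ℕ} (i : Fin (n + 1)) (u : Fin n → ℂ) : insertOne i u ≠ 0 :=
  fun h => by simpa using congrFun h i

theorem contDiff_insertOne_apply {n : ℕ} (i c : Fin (n + 1)) :
    ContDiff ℂ ω fun u : Fin n → ℂ => insertOne i u c := by
  refine Fin.succAboveCases i ?_ (fun a => ?_) c
  · simpa using contDiff_const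
  · simpa using contDiff_apply ℂ ℂ a

theorem contDiff_insertOne {n : ℕ} (i : Fin (n + 1)) :
    ContDiff ℂ ω fun u : Fin n → ℂ => insertOne i u :=
  contDiff_pi.2 (contDiff_insertOne_apply i)

/-! ## Projectivized sums of line bundles over projective space -/

/-- Combinatorial data for an embedding in `ℂℙᵐ × ℂℙᵖ` of the projectivization of the sum of the
line bundles with degrees `d₀, …, d_q` over `ℂℙᵖ`: the homogeneous coordinates of `ℂℙᵐ` are the
monomials `s_j w_i^{d_j}` with `j = σ c`, `i = τ c`, and `e j i` is the index of `s_j w_i^{d_j}`. -/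
structure SplitBundle (p q r m : ℕ) where
  σ : Fin (m + 1) → Fin (q + 1)
  τ : Fin (m + 1) → Fin (p + 1)
  d : Fin (q + 1) → ℕ
  e : Fin (q + 1) → Fin (p + 1) → Fin (m + 1)
  σ_e : ∀ j i, σ (e j i) = j
  τ_e : ∀ j i, d j = 0 ∨ τ (e j i) = i
  dim_eq : p + q = r

namespace SplitBundle

variable {p q r m : ℕ} (D : SplitBundle p q r m)

/-- The homogeneous coordinates `s_j w_i^{d_j}`. -/
def homog (w : Fin (p + 1) → ℂ) (s : Fin (q + 1) → ℂ) : Fin (m + 1) → ℂ :=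
  fun c => s (D.σ c) * w (D.τ c) ^ D.d (D.σ c)

/-- If `d j = 0`, the monomial is just `s j`, so one coordinate may serve for all `i`; this is why
`τ_e` is a disjunction. -/
theorem homog_e (w : Fin (p + 1) → ℂ) (s : Fin (q + 1) → ℂ) (j : Fin (q + 1)) (i : Fin (p + 1)) :
    D.homog w s (D.e j i) = s j * w i ^ D.d j := by
  rw [homog, D.σ_e]
  rcases D.τ_e j i with h | h <;> simp [h]

theorem homog_ne_zero {w : Fin (p + 1) → ℂ} {s : Fin (q + 1) → ℂ} (hw : w ≠ 0) (hs : s ≠ 0) :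
    D.homog w s ≠ 0 := by
  obtain ⟨i, hi⟩ := Function.ne_iff.1 hw
  obtain ⟨j, hj⟩ := Function.ne_iff.1 hs
  intro h
  have := congrFun h (D.e j i)
  rw [homog_e] at this
  exact mul_ne_zero hj (pow_ne_zero _ hi) this

/-- The total space. -/
def carrier : Set (CP m × CP p) :=
  {x | ∃ (w : Fin (p + 1) → ℂ) (s : Fin (q + 1) → ℂ) (hw : w ≠ 0) (hs : s ≠ 0),
    x = (Projectivization.mk ℂ (D.homog w s) (D.homog_ne_zero hw hs), Projectivization.mk ℂ w hw)}

/-- The point with homogeneous coordinates `w` in the base and `s` in the fiber. -/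
def point (w : Fin (p + 1) → ℂ) (s : Fin (q + 1) → ℂ) (hw : w ≠ 0) (hs : s ≠ 0) : D.carrier :=
  ⟨(Projectivization.mk ℂ (D.homog w s) (D.homog_ne_zero hw hs), Projectivization.mk ℂ w hw),
    w, s, hw, hs, rfl⟩

theorem exists_eq_point (x : D.carrier) : ∃ w s hw hs, x = D.point w s hw hs := by
  obtain ⟨x, w, s, hw, hs, rfl⟩ := x
  exact ⟨w, s, hw, hs, rfl⟩

/-- Scaling `w` by `t` multiplies `s_j w_i^{d_j}` by `t^{d_j}`, which the fibre coordinates have to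
compensate up to one common factor `u`. -/
theorem point_eq_point {w w' : Fin (p + 1) → ℂ} {s s' : Fin (q + 1) → ℂ} {hw : w ≠ 0} {hs : s ≠ 0}
    {hw' : w' ≠ 0} {hs' : s' ≠ 0} (t u : ℂ) (hww : ∀ i, w' i = t * w i)
    (hss : ∀ j, t ^ D.d j * s' j = u * s j) : D.point w' s' hw' hs' = D.point w s hw hs := by
  refine Subtype.ext (Prod.ext ?_ ?_)
  · refine (Projectivization.mk_eq_mk_iff' _ _ _ _ _).2 ⟨u, funext fun c => ?_⟩
    simp only [homog, Pi.smul_apply, smul_eq_mul, hww, mul_pow]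
    linear_combination -w (D.τ c) ^ D.d (D.σ c) * hss (D.σ c)
  · exact (Projectivization.mk_eq_mk_iff' _ _ _ _ _).2 ⟨t, funext fun i => (hww i).symm⟩

/-- With the same representative `w` there is no twist: for one `i` with `w i ≠ 0`, the factor `w i
^ d j` cancels from the `j`-th monomials. -/
theorem eq_smul_of_point_eq {w : Fin (p + 1) → ℂ} {s s' : Fin (q + 1) → ℂ} {hw : w ≠ 0} {hs : s ≠ 0}
    {hs' : s' ≠ 0} (h : D.point w s hw hs = D.point w s' hw hs') :
    ∃ u : ℂ, ∀ j, s j = u * s' j := by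
  obtain ⟨u, hu⟩ := (Projectivization.mk_eq_mk_iff' _ _ _ _ _).1 (congrArg (fun x => x.1.1) h)
  obtain ⟨i, hi⟩ := Function.ne_iff.1 hw
  refine ⟨u, fun j => ?_⟩
  have := congrFun hu (D.e j i)
  simp only [Pi.smul_apply, homog_e, smul_eq_mul] at this
  refine mul_right_cancel₀ (pow_ne_zero (D.d j) hi) ?_
  rw [← this, mul_assoc]

theorem base_eq_smul_of_point_eq {w w' : Fin (p + 1) → ℂ} {s s' : Fin (q + 1) → ℂ} {hw : w ≠ 0}
    {hs : s ≠ 0} {hw' : w' ≠ 0} {hs' : s' ≠ 0} (h : D.point w s hw hs = D.point w' s' hw' hs') :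
    ∃ t : ℂ, ∀ i, w i = t * w' i := by
  obtain ⟨t, ht⟩ := (Projectivization.mk_eq_mk_iff' _ _ _ _ _).1 (congrArg (fun x => x.1.2) h)
  exact ⟨t, fun i => (congrFun ht i).symm⟩

theorem continuous_point {T : Type*} [TopologicalSpace T] {w : T → Fin (p + 1) → ℂ}
    {s : T → Fin (q + 1) → ℂ} (hw : ∀ t, w t ≠ 0) (hs : ∀ t, s t ≠ 0) (hwc : Continuous w)
    (hsc : Continuous s) : Continuous fun t => D.point (w t) (s t) (hw t) (hs t) := by
  refine Continuous.subtype_mk (Continuous.prodMk ?_ ?_) _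
  · refine CP.isQuotientMap_mk'.continuous.comp (Continuous.subtype_mk
      (f := fun t => D.homog (w t) (s t)) ?_ fun t => D.homog_ne_zero (hw t) (hs t))
    refine continuous_pi fun c => ?_
    unfold homog
    fun_prop
  · exact CP.isQuotientMap_mk'.continuous.comp (Continuous.subtype_mk hwc hw)

/-! ### Charts -/

theorem point_snd_mem_affineSet {w : Fin (p + 1) → ℂ} {s : Fin (q + 1) → ℂ} (hw : w ≠ 0)
    (hs : s ≠ 0) (i : Fin (p + 1)) : (D.point w s hw hs).1.2 ∈ CP.affineSet i ↔ w i ≠ 0 :=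
  CP.mk_mem_affineSet _ _ _

theorem point_fst_mem_affineSet {w : Fin (p + 1) → ℂ} {s : Fin (q + 1) → ℂ} (hw : w ≠ 0)
    (hs : s ≠ 0) (c : Fin (m + 1)) :
    (D.point w s hw hs).1.1 ∈ CP.affineSet c ↔ D.homog w s c ≠ 0 :=
  CP.mk_mem_affineSet _ _ _

/-- The domain of the chart at the `(i, j)`-th fixed point. -/
def domain (ij : Fin (p + 1) × Fin (q + 1)) : Set D.carrier :=
  {x | x.1.2 ∈ CP.affineSet ij.1 ∧ x.1.1 ∈ CP.affineSet (D.e ij.2 ij.1)}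

theorem isOpen_domain (ij : Fin (p + 1) × Fin (q + 1)) : IsOpen (D.domain ij) :=
  ((CP.isOpen_affineSet _).preimage (continuous_snd.comp continuous_subtype_val)).inter
    ((CP.isOpen_affineSet _).preimage (continuous_fst.comp continuous_subtype_val))

theorem point_mem_domain {w : Fin (p + 1) → ℂ} {s : Fin (q + 1) → ℂ} (hw : w ≠ 0)
    (hs : s ≠ 0) (ij : Fin (p + 1) × Fin (q + 1)) :
    D.point w s hw hs ∈ D.domain ij ↔ w ij.1 ≠ 0 ∧ s ij.2 ≠ 0 := by
  change _ ∧ _ ↔ _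
  rw [point_snd_mem_affineSet, point_fst_mem_affineSet, homog_e]
  refine and_congr_right fun h => ?_
  simp [h]

/-- The affine coordinates around the `(i, j)`-th fixed point. -/
def coords (ij : Fin (p + 1) × Fin (q + 1)) (x : D.carrier) : (Fin p → ℂ) × (Fin q → ℂ) :=
  (fun a => CP.ratio (ij.1.succAbove a) ij.1 x.1.2,
    fun b => CP.ratio (D.e (ij.2.succAbove b) ij.1) (D.e ij.2 ij.1) x.1.1)

theorem coords_point {w : Fin (p + 1) → ℂ} {s : Fin (q + 1) → ℂ} (hw : w ≠ 0)
    (hs : s ≠ 0) (ij : Fin (p + 1) × Fin (q + 1)) :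
    D.coords ij (D.point w s hw hs) = (fun a => w (ij.1.succAbove a) / w ij.1,
      fun b => (s (ij.2.succAbove b) * w ij.1 ^ D.d (ij.2.succAbove b)) /
        (s ij.2 * w ij.1 ^ D.d ij.2)) := by
  refine Prod.ext (funext fun a => ?_) (funext fun b => ?_)
  · exact CP.ratio_mk _ _ _ _
  · simp only
    rw [← homog_e, ← homog_e]
    exact CP.ratio_mk _ _ _ _

/-- The point with given affine coordinates. -/
def ofCoords (ij : Fin (p + 1) × Fin (q + 1)) (y : (Fin p → ℂ) × (Fin q → ℂ)) : D.carrier :=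
  D.point (insertOne ij.1 y.1) (insertOne ij.2 y.2) (insertOne_ne_zero _ _) (insertOne_ne_zero _ _)

theorem ofCoords_mem_domain (ij : Fin (p + 1) × Fin (q + 1)) (y : (Fin p → ℂ) × (Fin q → ℂ)) :
    D.ofCoords ij y ∈ D.domain ij := by
  simp [ofCoords, point_mem_domain]

theorem coords_ofCoords (ij : Fin (p + 1) × Fin (q + 1)) (y : (Fin p → ℂ) × (Fin q → ℂ)) :
    D.coords ij (D.ofCoords ij y) = y := by
  rw [ofCoords, coords_point]
  simp

theorem ofCoords_coords {ij : Fin (p + 1) × Fin (q + 1)} {x : D.carrier} (hx : x ∈ D.domain ij) :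
    D.ofCoords ij (D.coords ij x) = x := by
  obtain ⟨w, s, hw, hs, rfl⟩ := D.exists_eq_point x
  obtain ⟨hwi, hsj⟩ := (D.point_mem_domain hw hs ij).1 hx
  obtain ⟨i, j⟩ := ij
  rw [coords_point]
  -- These scalars normalize the base coordinate `i` and then the monomial `s_j w_i^{d_j}` to one.
  refine D.point_eq_point (w i)⁻¹ (s j * w i ^ D.d j)⁻¹ (fun a => ?_) (fun b => ?_)
  · refine Fin.succAboveCases i ?_ (fun a => ?_) a
    · simp [hwi]
    · simp [div_eq_inv_mul]
  · refine Fin.succAboveCases j ?_ (fun b => ?_) b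
    · simp only at hwi hsj
      simp [field]
    · simp only at hwi hsj
      simp [field]

theorem continuous_ofCoords (ij : Fin (p + 1) × Fin (q + 1)) : Continuous (D.ofCoords ij) :=
  D.continuous_point _ _ ((contDiff_insertOne _).continuous.comp continuous_fst)
    ((contDiff_insertOne _).continuous.comp continuous_snd)

theorem continuousOn_coords (ij : Fin (p + 1) × Fin (q + 1)) :
    ContinuousOn (D.coords ij) (D.domain ij) := by
  refine ContinuousOn.prodMk (continuousOn_pi.2 fun a => ?_) (continuousOn_pi.2 fun b => ?_)
  · exact (CP.continuousOn_ratio _ _).comp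
      (continuous_snd.comp continuous_subtype_val).continuousOn fun x hx => hx.1
  · exact (CP.continuousOn_ratio _ _).comp
      (continuous_fst.comp continuous_subtype_val).continuousOn fun x hx => hx.2

/-- The identification of the space of affine coordinates with `ℂʳ`. -/
def modelEquiv : ((Fin p → ℂ) × (Fin q → ℂ)) ≃L[ℂ] (Fin r → ℂ) :=
  ContinuousLinearEquiv.ofFinrankEq (by simp [D.dim_eq])

/-- The affine chart around the `(i, j)`-th fixed point. -/
def chart (ij : Fin (p + 1) × Fin (q + 1)) : OpenPartialHomeomorph D.carrier (Fin r → ℂ) where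
  toFun x := D.modelEquiv (D.coords ij x)
  invFun y := D.ofCoords ij (D.modelEquiv.symm y)
  source := D.domain ij
  target := Set.univ
  map_source' _ _ := Set.mem_univ _
  map_target' _ _ := D.ofCoords_mem_domain _ _
  left_inv' x hx := by simp [D.ofCoords_coords hx]
  right_inv' y _ := by simp [D.coords_ofCoords]
  open_source := D.isOpen_domain ij
  open_target := isOpen_univ
  continuousOn_toFun := D.modelEquiv.continuous.comp_continuousOn (D.continuousOn_coords ij)
  continuousOn_invFun := ((D.continuous_ofCoords ij).comp D.modelEquiv.symm.continuous).continuousOn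

theorem chart_apply (ij : Fin (p + 1) × Fin (q + 1)) (x : D.carrier) :
    D.chart ij x = D.modelEquiv (D.coords ij x) := rfl

theorem exists_mem_domain (x : D.carrier) : ∃ ij, x ∈ D.domain ij := by
  obtain ⟨w, s, hw, hs, rfl⟩ := D.exists_eq_point x
  obtain ⟨i, hi⟩ := Function.ne_iff.1 hw
  obtain ⟨j, hj⟩ := Function.ne_iff.1 hs
  exact ⟨(i, j), (D.point_mem_domain hw hs _).2 ⟨hi, hj⟩⟩

/-- The index of the preferred chart at `x`; it only depends on the set of all charts around `x`. -/
def index (x : D.carrier) : Fin (p + 1) × Fin (q + 1) :=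
  Classical.epsilon fun ij => x ∈ D.domain ij

theorem mem_domain_index (x : D.carrier) : x ∈ D.domain (D.index x) :=
  Classical.epsilon_spec (D.exists_mem_domain x)

/-- Chart domains are torus invariant, so this makes the preferred chart constant along orbits, and
derivatives of the action need no change of chart. -/
theorem index_congr {x x' : D.carrier} (h : ∀ ij, x ∈ D.domain ij ↔ x' ∈ D.domain ij) :
    D.index x = D.index x' := by
  unfold index
  congr 1
  exact funext fun ij => propext (h ij)

instance instChartedSpace : ChartedSpace (Fin r → ℂ) D.carrier where
  atlas := Set.range D.chart
  chartAt x := D.chart (D.index x)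
  mem_chart_source x := D.mem_domain_index x
  chart_mem_atlas _ := Set.mem_range_self _

theorem chartAt_eq (x : D.carrier) : chartAt (Fin r → ℂ) x = D.chart (D.index x) := rfl

instance instIsManifold : IsManifold 𝓘(ℂ, Fin r → ℂ) ω D.carrier := by
  refine isManifold_of_contDiffOn _ _ _ ?_
  rintro _ _ ⟨ij, rfl⟩ ⟨kl, rfl⟩
  have hw : ∀ c, ContDiff ℂ ω fun y : Fin r → ℂ => insertOne ij.1 (D.modelEquiv.symm y).1 c :=
    fun c => (contDiff_insertOne_apply ij.1 c).comp
      (contDiff_fst.comp D.modelEquiv.symm.contDiff)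
  have hs : ∀ c, ContDiff ℂ ω fun y : Fin r → ℂ => insertOne ij.2 (D.modelEquiv.symm y).2 c :=
    fun c => (contDiff_insertOne_apply ij.2 c).comp
      (contDiff_snd.comp D.modelEquiv.symm.contDiff)
  -- Transition maps are quotients of monomials in coordinates, and the denominators do not vanish
  -- on the overlap.
  have key : ContDiffOn ℂ ω
      (fun y : Fin r → ℂ => D.modelEquiv (D.coords kl (D.ofCoords ij (D.modelEquiv.symm y))))
      {y | insertOne ij.1 (D.modelEquiv.symm y).1 kl.1 ≠ 0 ∧
        insertOne ij.2 (D.modelEquiv.symm y).2 kl.2 ≠ 0} := by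
    refine D.modelEquiv.contDiff.comp_contDiffOn ?_
    simp only [ofCoords, coords_point]
    refine ContDiffOn.prodMk (contDiffOn_pi.2 fun a => ?_) (contDiffOn_pi.2 fun b => ?_)
    · exact (hw _).contDiffOn.div (hw _).contDiffOn fun y hy => hy.1
    · refine ContDiffOn.div ((hs _).mul ((hw _).pow _)).contDiffOn
        ((hs _).mul ((hw _).pow _)).contDiffOn fun y hy => ?_
      exact mul_ne_zero hy.2 (pow_ne_zero _ hy.1)
  refine key.mono fun y hy => ?_
  exact (D.point_mem_domain (insertOne_ne_zero _ _) (insertOne_ne_zero _ _) kl).1 hy.1.2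

instance instIsManifoldReal : IsManifold 𝓘(ℝ, Fin r → ℂ) ∞ D.carrier := IsManifold.real_of_complex

/-! ### The embedding in the product of projective spaces -/

theorem homog_insertOne_e (ij : Fin (p + 1) × Fin (q + 1)) (y : (Fin p → ℂ) × (Fin q → ℂ))
    (j : Fin (q + 1)) : D.homog (insertOne ij.1 y.1) (insertOne ij.2 y.2) (D.e j ij.1) =
      insertOne ij.2 y.2 j := by
  rw [homog_e, insertOne_same, one_pow, mul_one]

/-- The inclusion in affine coordinates. -/
def graphMap (ij : Fin (p + 1) × Fin (q + 1)) (y : Fin r → ℂ) : (Fin m → ℂ) × (Fin p → ℂ) :=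
  (fun c => D.homog (insertOne ij.1 (D.modelEquiv.symm y).1)
      (insertOne ij.2 (D.modelEquiv.symm y).2)
    ((D.e ij.2 ij.1).succAbove c), (D.modelEquiv.symm y).1)

theorem contDiff_graphMap (ij : Fin (p + 1) × Fin (q + 1)) : ContDiff ℂ ω (D.graphMap ij) := by
  refine ContDiff.prodMk (contDiff_pi.2 fun c => ?_) (contDiff_fst.comp D.modelEquiv.symm.contDiff)
  exact ((contDiff_insertOne_apply ij.2 _).comp
      (contDiff_snd.comp D.modelEquiv.symm.contDiff)).mul
    (((contDiff_insertOne_apply ij.1 _).comp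
      (contDiff_fst.comp D.modelEquiv.symm.contDiff)).pow _)

/-- `σ` recovers the fibre index, so the monomials of different summands are different coordinates.
Each fibre coordinate is thus literally an affine coordinate of the ambient chart, which makes the
left inverse linear. -/
theorem exists_succAbove_eq_e (ij : Fin (p + 1) × Fin (q + 1)) (b : Fin q) :
    ∃ c, (D.e ij.2 ij.1).succAbove c = D.e (ij.2.succAbove b) ij.1 := by
  refine Fin.exists_succAbove_eq fun h => ?_
  have := congrArg D.σ h
  rw [D.σ_e, D.σ_e] at this
  exact Fin.succAbove_ne _ _ this

/-- The linear projection that recovers a point from its image. -/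
def graphProj (ij : Fin (p + 1) × Fin (q + 1)) : ((Fin m → ℂ) × (Fin p → ℂ)) →L[ℂ] (Fin r → ℂ) :=
  D.modelEquiv.toContinuousLinearMap.comp ((ContinuousLinearMap.snd ℂ (Fin m → ℂ) (Fin p → ℂ)).prod
    (ContinuousLinearMap.pi fun b =>
      (ContinuousLinearMap.proj (R := ℂ) (φ := fun _ : Fin m => ℂ)
        (D.exists_succAbove_eq_e ij b).choose).comp
        (ContinuousLinearMap.fst ℂ (Fin m → ℂ) (Fin p → ℂ))))

theorem graphProj_graphMap (ij : Fin (p + 1) × Fin (q + 1)) (y : Fin r → ℂ) :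
    D.graphProj ij (D.graphMap ij y) = y := by
  have : ((D.graphMap ij y).2, fun b => (D.graphMap ij y).1 (D.exists_succAbove_eq_e ij b).choose) =
      D.modelEquiv.symm y := by
    refine Prod.ext rfl (funext fun b => ?_)
    simp only [graphMap]
    rw [(D.exists_succAbove_eq_e ij b).choose_spec, homog_insertOne_e, insertOne_succAbove]
  change D.modelEquiv ((D.graphMap ij y).2, fun b => (D.graphMap ij y).1 _) = y
  rw [this, ContinuousLinearEquiv.apply_symm_apply]

theorem isSmoothEmbedding_val : Manifold.IsSmoothEmbedding 𝓘(ℂ, Fin r → ℂ)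
    (𝓘(ℂ, Fin m → ℂ).prod 𝓘(ℂ, Fin p → ℂ)) ω (Subtype.val : D.carrier → CP m × CP p) := by
  refine ⟨⟨Fin (m + p - r) → ℂ, inferInstance, inferInstance, fun x => ?_⟩, IsEmbedding.subtypeVal⟩
  set ij := D.index x
  have hsurj : Function.Surjective (D.graphProj ij).toLinearMap := fun y =>
    ⟨D.graphMap ij y, D.graphProj_graphMap ij y⟩
  obtain ⟨ι, hι⟩ := LinearMap.exists_rightInverse_of_surjective (D.graphProj ij).toLinearMap
    (LinearMap.range_eq_top.2 hsurj)
  -- One complement must work at all points; by rank and nullity the kernels have the same dimension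
  -- in all charts.
  have hker : Module.finrank ℂ (Fin (m + p - r) → ℂ) = Module.finrank ℂ (D.graphProj ij).ker := by
    have h1 := LinearMap.finrank_range_add_finrank_ker (D.graphProj ij).toLinearMap
    rw [LinearMap.range_eq_top.2 hsurj] at h1
    simp only [finrank_top, Module.finrank_prod, Module.finrank_fintype_fun_eq_card,
      Fintype.card_fin] at h1 ⊢
    change m + p - r = Module.finrank ℂ (LinearMap.ker (D.graphProj ij).toLinearMap)
    omega
  refine isImmersionAtOfComplement_of_leftInverse (φ := D.chart ij)
    (ψ₁ := CP.affineChart (D.e ij.2 ij.1)) (ψ₂ := CP.affineChart ij.1)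
    ((contDiffGroupoid ω 𝓘(ℂ, Fin r → ℂ)).subset_maximalAtlas ⟨ij, rfl⟩) ⟨_, rfl⟩ ⟨_, rfl⟩
    (D.mem_domain_index x) (fun x hx => ⟨hx.2, hx.1⟩) (D.graphMap ij) (D.contDiff_graphMap ij)
    (D.graphProj ij) (LinearMap.toContinuousLinearMap ι) (D.graphProj_graphMap ij)
    (fun y => LinearMap.congr_fun hι y) (fun y _ => ?_) (ContinuousLinearEquiv.ofFinrankEq hker)
  refine Prod.ext (funext fun c => ?_) (funext fun a => ?_)
  · refine (CP.affineCoord_mk _ _ _ _).trans ?_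
    rw [homog_insertOne_e, insertOne_same, div_one]
    rfl
  · refine (CP.affineCoord_mk _ _ _ _).trans ?_
    rw [insertOne_same, insertOne_succAbove, div_one]
    rfl

/-! ### Compactness and connectedness -/

/-- Every point has homogeneous coordinates of norm one. -/
theorem exists_eq_point_norm_one (x : D.carrier) :
    ∃ w s hw hs, ‖w‖ = 1 ∧ ‖s‖ = 1 ∧ x = D.point w s hw hs := by
  obtain ⟨w, s, hw, hs, rfl⟩ := D.exists_eq_point x
  have hw' : (‖w‖ : ℂ) ≠ 0 := by simpa using hw
  -- The base is normalized first; `s'` absorbs the resulting twist and is then normalized itself.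
  let s' : Fin (q + 1) → ℂ := fun j => (‖w‖ : ℂ) ^ D.d j * s j
  have hs' : s' ≠ 0 := by
    obtain ⟨j, hj⟩ := Function.ne_iff.1 hs
    exact Function.ne_iff.2 ⟨j, mul_ne_zero (pow_ne_zero _ hw') hj⟩
  have hs'' : (‖s'‖ : ℂ) ≠ 0 := by simpa using hs'
  refine ⟨(‖w‖ : ℂ)⁻¹ • w, (‖s'‖ : ℂ)⁻¹ • s', smul_ne_zero (inv_ne_zero hw') hw,
    smul_ne_zero (inv_ne_zero hs'') hs', ?_, ?_, ?_⟩
  · rw [norm_smul, norm_inv, Complex.norm_real, norm_norm, inv_mul_cancel₀ (norm_ne_zero_iff.2 hw)]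
  · rw [norm_smul, norm_inv, Complex.norm_real, norm_norm, inv_mul_cancel₀ (norm_ne_zero_iff.2 hs')]
  · symm
    refine D.point_eq_point (‖w‖ : ℂ)⁻¹ (‖s'‖ : ℂ)⁻¹ (fun i => rfl) fun j => ?_
    simp only [Pi.smul_apply, smul_eq_mul, s', inv_pow]
    field_simp

/-- The space is a continuous image of a product of two unit spheres for the sup norm. -/
instance instCompactSpace : CompactSpace D.carrier := by
  let S (n : ℕ) := Metric.sphere (0 : Fin (n + 1) → ℂ) 1
  have hS : ∀ {n : ℕ} (v : S n), v.1 ≠ 0 := fun v => ne_zero_of_mem_unit_sphere v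
  have hc : Continuous fun v : S p × S q => D.point v.1.1 v.2.1 (hS _) (hS _) :=
    D.continuous_point _ _ (by fun_prop) (by fun_prop)
  refine ⟨?_⟩
  rw [← (?_ : Set.range (fun v : S p × S q => D.point v.1.1 v.2.1 (hS _) (hS _)) = Set.univ)]
  · exact isCompact_range hc
  · refine Set.eq_univ_of_forall fun x => ?_
    obtain ⟨w, s, hw, hs, hw1, hs1, rfl⟩ := D.exists_eq_point_norm_one x
    exact ⟨(⟨w, by simpa [S] using hw1⟩, ⟨s, by simpa [S] using hs1⟩), rfl⟩

/-- The real dimension `2 (n + 1)` exceeds one. Besides connectedness of the whole space, the case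
`n = 1` yields the projective lines that join fixed points. -/
theorem isConnected_compl_zero (n : ℕ) : IsConnected ({0}ᶜ : Set (Fin (n + 1) → ℂ)) := by
  refine isConnected_compl_singleton_of_one_lt_rank ?_ 0
  rw [← Module.finrank_eq_rank, ← Nat.cast_one, Nat.cast_lt]
  simp only [Module.finrank_pi_fintype, Complex.finrank_real_complex, Finset.sum_const,
    Finset.card_univ, Fintype.card_fin, smul_eq_mul]
  omega

instance instConnectedSpace : ConnectedSpace D.carrier := by
  have : ∀ n, ConnectedSpace ({0}ᶜ : Set (Fin (n + 1) → ℂ)) := fun n =>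
    isConnected_iff_connectedSpace.1 (isConnected_compl_zero n)
  let f (v : ({0}ᶜ : Set (Fin (p + 1) → ℂ)) × ({0}ᶜ : Set (Fin (q + 1) → ℂ))) : D.carrier :=
    D.point v.1.1 v.2.1 v.1.2 v.2.2
  have hc : Continuous f := D.continuous_point _ _ (by fun_prop) (by fun_prop)
  refine Function.Surjective.connectedSpace (f := f) (fun x => ?_) hc
  obtain ⟨w, s, hw, hs, rfl⟩ := D.exists_eq_point x
  exact ⟨(⟨w, hw⟩, ⟨s, hs⟩), rfl⟩

end SplitBundle

/-! ## Cells of projective spaces -/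

/-- `i` is the largest index of a nonzero coordinate of `v`. -/
def IsTopIndex {n : ℕ} (v : Fin (n + 1) → ℂ) (i : Fin (n + 1)) : Prop :=
  v i ≠ 0 ∧ ∀ a, i < a → v a = 0

theorem exists_isTopIndex {n : ℕ} {v : Fin (n + 1) → ℂ} (hv : v ≠ 0) : ∃ i, IsTopIndex v i := by
  classical
  obtain ⟨i, hi⟩ := Function.ne_iff.1 hv
  have hne : (Finset.univ.filter fun a => v a ≠ 0).Nonempty := ⟨i, by simpa using hi⟩
  refine ⟨_, (Finset.mem_filter.1 (Finset.max'_mem _ hne)).2, fun a ha => ?_⟩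
  by_contra h
  exact absurd (Finset.le_max' _ a (by simpa using h)) (not_le.2 ha)

/-- The top index depends only on the line, so it tells which cell a point lies in. -/
theorem IsTopIndex.eq_of_smul {n : ℕ} {v v' : Fin (n + 1) → ℂ} {i i' : Fin (n + 1)}
    (h : IsTopIndex v i) (h' : IsTopIndex v' i') {t : ℂ} (ht : ∀ a, v a = t * v' a) : i = i' := by
  have ht0 : t ≠ 0 := by
    rintro rfl
    exact h.1 (by simp [ht])
  refine le_antisymm (not_lt.1 fun hlt => ?_) (not_lt.1 fun hlt => ?_)
  · exact h.1 (by rw [ht, h'.2 _ hlt, mul_zero])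
  · exact mul_ne_zero ht0 h'.1 (by rw [← ht, h.2 _ hlt])

/-- The index set of the real coordinates of the `i`-th cell of projective space. -/
abbrev CellIndex {n : ℕ} (i : Fin (n + 1)) : Type := {a : Fin (n + 1) // a < i} × Fin 2

theorem card_cellIndex {n : ℕ} (i : Fin (n + 1)) : Fintype.card (CellIndex i) = i * 2 := by
  rw [Fintype.card_prod, Fintype.card_fin, Fintype.card_subtype]
  congr 1
  rw [show (Finset.univ.filter fun a => a < i) = Finset.Iio i by ext; simp, Fin.card_Iio]

/-- Homogeneous coordinates `[x : 1 - ‖x‖ : 0 : … : 0]` of the characteristic map of the `i`-th cell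
of projective space. -/
def cellVec {n : ℕ} (i : Fin (n + 1)) (x : CellIndex i → ℝ) : Fin (n + 1) → ℂ := fun a =>
  if h : a < i then x (⟨a, h⟩, 0) + x (⟨a, h⟩, 1) * Complex.I
  else if a = i then ((1 - ‖x‖ : ℝ) : ℂ) else 0

section cellVec

variable {n : ℕ} {i : Fin (n + 1)}

theorem cellVec_of_lt (x : CellIndex i → ℝ) {a : Fin (n + 1)} (h : a < i) :
    cellVec i x a = x (⟨a, h⟩, 0) + x (⟨a, h⟩, 1) * Complex.I := by
  simp [cellVec, h]

theorem cellVec_self (x : CellIndex i → ℝ) : cellVec i x i = ((1 - ‖x‖ : ℝ) : ℂ) := by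
  simp [cellVec]

theorem cellVec_of_gt (x : CellIndex i → ℝ) {a : Fin (n + 1)} (h : i < a) : cellVec i x a = 0 := by
  simp [cellVec, h.not_gt, h.ne']

theorem continuous_cellVec : Continuous (cellVec i) := by
  refine continuous_pi fun a => ?_
  rcases lt_trichotomy a i with h | rfl | h
  · simp only [cellVec_of_lt _ h]
    fun_prop
  · simp only [cellVec_self]
    fun_prop
  · simp only [cellVec_of_gt _ h]
    fun_prop

/-- If the entries below `i` vanish, then `x = 0` and the entry at `i` is one. -/
theorem cellVec_ne_zero (x : CellIndex i → ℝ) : cellVec i x ≠ 0 := by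
  intro h
  have hx : x = 0 := by
    funext ⟨⟨a, ha⟩, k⟩
    have := congrFun h a
    rw [cellVec_of_lt _ ha] at this
    have h0 := congrArg Complex.re this
    have h1 := congrArg Complex.im this
    simp only [Complex.add_re, Complex.ofReal_re, Complex.mul_re, Complex.I_re, mul_zero,
      Complex.ofReal_im, Complex.I_im, mul_one, sub_self, add_zero, Pi.zero_apply,
      Complex.zero_re, Complex.add_im, Complex.mul_im, zero_add, Complex.zero_im] at h0 h1
    fin_cases k
    · exact h0
    · exact h1
  have := congrFun h i
  rw [cellVec_self, hx] at this
  simp at this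

theorem isTopIndex_cellVec {x : CellIndex i → ℝ} (hx : ‖x‖ < 1) : IsTopIndex (cellVec i x) i := by
  refine ⟨?_, fun a ha => cellVec_of_gt x ha⟩
  rw [cellVec_self, Complex.ofReal_ne_zero]
  exact (sub_pos.2 hx).ne'

theorem le_of_isTopIndex_cellVec {x : CellIndex i → ℝ} {i' : Fin (n + 1)}
    (h : IsTopIndex (cellVec i x) i') : i' ≤ i :=
  not_lt.1 fun hlt => h.1 (cellVec_of_gt x hlt)

/-- On the unit sphere the entry `1 - ‖x‖` vanishes, so the boundary of a cell falls into smaller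
cells. -/
theorem lt_of_isTopIndex_cellVec {x : CellIndex i → ℝ} {i' : Fin (n + 1)} (hx : ‖x‖ = 1)
    (h : IsTopIndex (cellVec i x) i') : i' < i := by
  refine (le_of_isTopIndex_cellVec h).lt_of_ne ?_
  rintro rfl
  exact h.1 (by simp [cellVec_self, hx])

/-- The entries at `i` are positive reals, so `t` is a positive real `u` and `x = u x'`. Then `1 - u
‖x'‖ = u (1 - ‖x'‖)` forces `u = 1`. -/
theorem cellVec_injective_of_smul {x x' : CellIndex i → ℝ} (hx : ‖x‖ < 1) (hx' : ‖x'‖ < 1) {t : ℂ}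
    (h : ∀ a, cellVec i x a = t * cellVec i x' a) : x = x' := by
  have hpos : 0 < 1 - ‖x‖ := sub_pos.2 hx
  have hpos' : 0 < 1 - ‖x'‖ := sub_pos.2 hx'
  obtain ⟨u, hu, rfl⟩ : ∃ u : ℝ, 0 < u ∧ t = u := by
    refine ⟨(1 - ‖x‖) / (1 - ‖x'‖), div_pos hpos hpos', ?_⟩
    have := h i
    rw [cellVec_self, cellVec_self] at this
    rw [Complex.ofReal_div, this, mul_div_cancel_right₀]
    exact Complex.ofReal_ne_zero.2 hpos'.ne'
  have hxu : x = u • x' := by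
    funext ⟨⟨a, ha⟩, k⟩
    have := h a
    rw [cellVec_of_lt _ ha, cellVec_of_lt _ ha] at this
    have h0 := congrArg Complex.re this
    have h1 := congrArg Complex.im this
    simp at h0 h1
    fin_cases k
    · exact h0
    · exact h1
  have hself := h i
  rw [cellVec_self, cellVec_self, ← Complex.ofReal_mul, Complex.ofReal_inj, hxu, norm_smul,
    Real.norm_of_nonneg hu.le] at hself
  have : u = 1 := by linarith
  rw [hxu, this, one_smul]

theorem exists_cellVec_eq_smul {v : Fin (n + 1) → ℂ} (hv : IsTopIndex v i) :
    ∃ x : CellIndex i → ℝ, ‖x‖ < 1 ∧ ∃ t : ℂ, t ≠ 0 ∧ ∀ a, cellVec i x a = t * v a := by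
  -- `Y` holds the affine coordinates as real numbers. The preimage is `Y / (1 + ‖Y‖)`, since `x ↦ x
  -- / (1 - ‖x‖)` is inverse to `Y ↦ Y / (1 + ‖Y‖)`.
  let Y : CellIndex i → ℝ := fun b => if b.2 = 0 then (v b.1 / v i).re else (v b.1 / v i).im
  have hY : 0 < 1 + ‖Y‖ := by positivity
  have hY' : (1 + ‖Y‖ : ℂ) ≠ 0 := by exact_mod_cast hY.ne'
  have hnorm : ‖(1 + ‖Y‖)⁻¹ • Y‖ = 1 - (1 + ‖Y‖)⁻¹ := by
    rw [norm_smul, norm_inv, Real.norm_of_nonneg hY.le]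
    field_simp
    ring
  refine ⟨(1 + ‖Y‖)⁻¹ • Y, ?_, (1 + ‖Y‖ : ℂ)⁻¹ * (v i)⁻¹,
    mul_ne_zero (inv_ne_zero hY') (inv_ne_zero hv.1), fun a => ?_⟩
  · rw [hnorm]
    exact sub_lt_self _ (inv_pos.2 hY)
  · rcases lt_trichotomy a i with h | rfl | h
    · rw [cellVec_of_lt _ h]
      simp only [Pi.smul_apply, smul_eq_mul, Y, if_true, one_ne_zero, if_false, Complex.ofReal_mul]
      rw [mul_assoc, ← mul_add, Complex.re_add_im]
      push_cast
      ring
    · rw [cellVec_self, hnorm, mul_assoc, inv_mul_cancel₀ hv.1]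
      push_cast
      ring
    · rw [cellVec_of_gt _ h, hv.2 _ h, mul_zero]

end cellVec

/-! ## The cells of a projectivized sum of line bundles -/

theorem norm_comp_inl_le {α β : Type*} [Fintype α] [Fintype β] (x : α ⊕ β → ℝ) :
    ‖x ∘ Sum.inl‖ ≤ ‖x‖ :=
  (pi_norm_le_iff_of_nonneg (norm_nonneg _)).2 fun a => norm_le_pi_norm x (Sum.inl a)

theorem norm_comp_inr_le {α β : Type*} [Fintype α] [Fintype β] (x : α ⊕ β → ℝ) :
    ‖x ∘ Sum.inr‖ ≤ ‖x‖ :=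
  (pi_norm_le_iff_of_nonneg (norm_nonneg _)).2 fun a => norm_le_pi_norm x (Sum.inr a)

/-- For the sup norm a product of unit balls is a unit ball, so products of cells are again cells.
-/
theorem norm_sum_type {α β : Type*} [Fintype α] [Fintype β] (x : α ⊕ β → ℝ) :
    ‖x‖ = max ‖x ∘ Sum.inl‖ ‖x ∘ Sum.inr‖ := by
  refine le_antisymm ?_ (max_le (norm_comp_inl_le x) (norm_comp_inr_le x))
  refine (pi_norm_le_iff_of_nonneg (by positivity)).2 ?_
  rintro (a | b)
  · exact (norm_le_pi_norm (x ∘ Sum.inl) a).trans (le_max_left _ _)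
  · exact (norm_le_pi_norm (x ∘ Sum.inr) b).trans (le_max_right _ _)

namespace SplitBundle

variable {p q r m : ℕ} (D : SplitBundle p q r m)

/-- The index set of the real coordinates of the `(i, j)`-th cell. -/
abbrev PairIndex (ij : Fin (p + 1) × Fin (q + 1)) : Type := CellIndex ij.1 ⊕ CellIndex ij.2

/-- The characteristic map of the `(i, j)`-th cell. -/
def cellMap (ij : Fin (p + 1) × Fin (q + 1)) (x : PairIndex ij → ℝ) : D.carrier :=
  D.point (cellVec ij.1 (x ∘ Sum.inl)) (cellVec ij.2 (x ∘ Sum.inr)) (cellVec_ne_zero _)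
    (cellVec_ne_zero _)

theorem continuous_cellMap (ij : Fin (p + 1) × Fin (q + 1)) : Continuous (D.cellMap ij) :=
  D.continuous_point _ _ (continuous_cellVec.comp (by fun_prop))
    (continuous_cellVec.comp (by fun_prop))

theorem exists_cellMap_eq {w : Fin (p + 1) → ℂ} {s : Fin (q + 1) → ℂ} (hw : w ≠ 0) (hs : s ≠ 0)
    {i : Fin (p + 1)} {j : Fin (q + 1)} (hi : IsTopIndex w i) (hj : IsTopIndex s j) :
    ∃ x ∈ Metric.ball (0 : PairIndex (i, j) → ℝ) 1, D.cellMap (i, j) x = D.point w s hw hs := by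
  obtain ⟨x, hx, t, ht, hxw⟩ := exists_cellVec_eq_smul hi
  -- Normalizing the base by `t` twists the fibre coordinates by `t^{-d_b}`, which leaves the top
  -- index unchanged.
  have hj' : IsTopIndex (fun b => (t ^ D.d b)⁻¹ * s b) j :=
    ⟨mul_ne_zero (inv_ne_zero (pow_ne_zero _ ht)) hj.1, fun b hb => by simp [hj.2 b hb]⟩
  obtain ⟨y, hy, u, hu, hys⟩ := exists_cellVec_eq_smul hj'
  refine ⟨Sum.elim x y, ?_, D.point_eq_point t u hxw fun b => ?_⟩
  · rw [mem_ball_zero_iff, norm_sum_type]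
    exact max_lt hx hy
  · change t ^ D.d b * cellVec j y b = _
    rw [hys, mul_left_comm, mul_inv_cancel_left₀ (pow_ne_zero _ ht)]

/-- The base determines `i` and the base parameters. The base vectors are then equal, not just
proportional, so the fibre parts can be compared without a twist. -/
theorem cellMap_eq_cellMap {i i' : Fin (p + 1)} {j j' : Fin (q + 1)}
    {x : PairIndex (i, j) → ℝ} (hx : ‖x‖ < 1) {x' : PairIndex (i', j') → ℝ} (hx' : ‖x'‖ < 1)
    (h : D.cellMap (i, j) x = D.cellMap (i', j') x') : (i, j) = (i', j') := by
  have hxl := (norm_comp_inl_le x).trans_lt hx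
  have hxl' := (norm_comp_inl_le x').trans_lt hx'
  obtain ⟨t, ht⟩ := D.base_eq_smul_of_point_eq h
  obtain rfl : i = i' := (isTopIndex_cellVec hxl).eq_of_smul (isTopIndex_cellVec hxl') ht
  have hl : x ∘ Sum.inl = x' ∘ Sum.inl := cellVec_injective_of_smul hxl hxl' ht
  simp only [cellMap, hl] at h
  obtain ⟨u, hu⟩ := D.eq_smul_of_point_eq h
  obtain rfl : j = j' := (isTopIndex_cellVec ((norm_comp_inr_le x).trans_lt hx)).eq_of_smul
    (isTopIndex_cellVec ((norm_comp_inr_le x').trans_lt hx')) hu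
  rfl

theorem injOn_cellMap (ij : Fin (p + 1) × Fin (q + 1)) :
    Set.InjOn (D.cellMap ij) (Metric.ball 0 1) := by
  intro x hx x' hx' h
  rw [mem_ball_zero_iff] at hx hx'
  obtain ⟨t, ht⟩ := D.base_eq_smul_of_point_eq h
  have hl : x ∘ Sum.inl = x' ∘ Sum.inl := cellVec_injective_of_smul
    ((norm_comp_inl_le x).trans_lt hx) ((norm_comp_inl_le x').trans_lt hx') ht
  simp only [cellMap, hl] at h
  obtain ⟨u, hu⟩ := D.eq_smul_of_point_eq h
  have hr : x ∘ Sum.inr = x' ∘ Sum.inr := cellVec_injective_of_smul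
    ((norm_comp_inr_le x).trans_lt hx) ((norm_comp_inr_le x').trans_lt hx') hu
  funext k
  rcases k with k | k
  · exact congrFun hl k
  · exact congrFun hr k

theorem card_pairIndex (ij : Fin (p + 1) × Fin (q + 1)) :
    Fintype.card (PairIndex ij) = (ij.1 + ij.2 : ℕ) * 2 := by
  rw [Fintype.card_sum, card_cellIndex, card_cellIndex, add_mul]

/-- The Euler number of a `ℂℙ^q`-bundle over `ℂℙᵖ` is `(p + 1) (q + 1)`. -/
theorem hasEulerNumber : HasEulerNumber D.carrier ((p + 1) * (q + 1)) := by
  have hsum : ∑ ij : Fin (p + 1) × Fin (q + 1), (-1 : ℤ) ^ Fintype.card (PairIndex ij) =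
      (p + 1) * (q + 1) := by
    -- All cells have even dimension and count with sign `+1`.
    rw [Finset.sum_congr rfl (g := fun _ => (1 : ℤ)) fun ij _ => by
      rw [card_pairIndex, pow_mul']
      simp]
    simp
  rw [← hsum]
  refine hasEulerNumber_of_cells _ D.cellMap (fun ij => (D.continuous_cellMap ij).continuousOn)
    D.injOn_cellMap ?_ (fun x => ?_) fun ij x hx => ?_
  · rintro ⟨i, j⟩ ⟨i', j'⟩ x hx x' hx' h
    exact D.cellMap_eq_cellMap (by simpa using hx) (by simpa using hx') h
  · obtain ⟨w, s, hw, hs, rfl⟩ := D.exists_eq_point x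
    obtain ⟨i, hi⟩ := exists_isTopIndex hw
    obtain ⟨j, hj⟩ := exists_isTopIndex hs
    exact ⟨(i, j), D.exists_cellMap_eq hw hs hi hj⟩
  · obtain ⟨i', hi⟩ := exists_isTopIndex (cellVec_ne_zero (x ∘ Sum.inl))
    obtain ⟨j', hj⟩ := exists_isTopIndex (cellVec_ne_zero (x ∘ Sum.inr))
    refine ⟨(i', j'), ?_, D.exists_cellMap_eq _ _ hi hj⟩
    have hle := Fin.le_def.1 (le_of_isTopIndex_cellVec hi)
    have hle' := Fin.le_def.1 (le_of_isTopIndex_cellVec hj)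
    rw [card_pairIndex, card_pairIndex]
    rw [mem_sphere_zero_iff_norm, norm_sum_type] at hx
    -- On the boundary of the product one factor has norm one. Its top index drops strictly, and the
    -- other one does not rise.
    rcases max_choice ‖x ∘ Sum.inl‖ ‖x ∘ Sum.inr‖ with h | h
    · have := Fin.lt_def.1 (lt_of_isTopIndex_cellVec (h.symm.trans hx) hi)
      simp only
      omega
    · have := Fin.lt_def.1 (lt_of_isTopIndex_cellVec (h.symm.trans hx) hj)
      simp only
      omega

end SplitBundle

/-! ## Characters and weights -/

namespace Torus

variable {n : ℕ}

theorem char_neg (v : Fin n → ℤ) (g : Torus n) : char (-v) g = (char v g)⁻¹ := by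
  simp [char]

theorem char_sub (v w : Fin n → ℤ) (g : Torus n) : char (v - w) g = char v g / char w g := by
  rw [sub_eq_add_neg, char_add, char_neg, div_eq_mul_inv]

theorem char_exp (v : Fin n → ℤ) (θ : Fin n → ℝ) :
    char v (exp θ) = Circle.exp (∑ i, v i * θ i) := by
  have h : ∀ s : Finset (Fin n), Circle.exp (∑ i ∈ s, (v i : ℝ) * θ i) =
      ∏ i ∈ s, Circle.exp (θ i) ^ v i := by
    intro s
    induction s using Finset.cons_induction with
    | empty => simp
    | cons a s ha ih =>
      rw [Finset.sum_cons, Finset.prod_cons, Circle.exp_add, ih, ← zsmul_eq_mul, Circle.exp_zsmul]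
  exact (h Finset.univ).symm

theorem contDiff_char_exp (v : Fin n → ℤ) :
    ContDiff ℝ ∞ fun θ : Fin n → ℝ => (char v (exp θ) : ℂ) := by
  simp only [char_exp, Circle.coe_exp]
  refine ContDiff.cexp (ContDiff.mul ?_ contDiff_const)
  have h : ContDiff ℝ ∞ fun θ : Fin n → ℝ => ∑ i, (v i : ℝ) * θ i :=
    ContDiff.sum fun i _ => contDiff_const.mul (contDiff_apply ℝ ℝ i)
  exact Complex.ofRealCLM.contDiff.comp h

theorem exists_char_ne_one {v : Fin n → ℤ} (hv : v ≠ 0) : ∃ g : Torus n, char v g ≠ 1 := by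
  classical
  obtain ⟨i, hi⟩ := Function.ne_iff.1 hv
  -- At this element the character takes the value `e^{iπ} = -1`.
  refine ⟨exp (Pi.single i (Real.pi / v i)), ?_⟩
  have hi' : (v i : ℝ) ≠ 0 := by exact_mod_cast hi
  have hsum : ∑ k, (v k : ℝ) * (Pi.single i (Real.pi / v i) : Fin n → ℝ) k = Real.pi := by
    rw [Finset.sum_eq_single i (fun k _ hk => by simp [hk]) (by simp), Pi.single_eq_same,
      mul_div_cancel₀ _ hi']
  rw [char_exp, hsum]
  intro h
  have := congrArg (fun z : Circle => (z : ℂ)) h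
  simp only [Circle.coe_exp, Complex.exp_pi_mul_I, Circle.coe_one] at this
  norm_num at this

/-- An element of the torus on which a basis of the character lattice is trivial is trivial. -/
theorem eq_one_of_char_basis {ι : Type*} (B : Module.Basis ι ℤ (Fin n → ℤ)) {g : Torus n}
    (h : ∀ i, char (B i) g = 1) : g = 1 := by
  classical
  -- Evaluation of characters at `g` is additive, so vanishing on a basis forces vanishing on the
  -- standard basis, whose characters are the coordinates of `g`.
  let f : (Fin n → ℤ) →+ Additive Circle :=
    { toFun := fun v => Additive.ofMul (char v g)
      map_zero' := by simp [char_zero]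
      map_add' := fun v w => by simp [char_add] }
  have hf : f.toIntLinearMap = 0 := B.ext fun i => by
    change Additive.ofMul (char (B i) g) = 0
    rw [h]
    rfl
  funext i
  have h1 : char (Pi.single i 1) g = 1 := LinearMap.congr_fun hf (Pi.single i 1)
  refine Eq.trans ?_ h1
  simp only [char, MonoidHom.coe_mk, OneHom.coe_mk]
  rw [Finset.prod_eq_single i (fun k _ hk => by simp [hk]) (by simp)]
  simp

end Torus

section RealBasis

variable {E : Type*} [NormedAddCommGroup E] [NormedSpace ℂ E] [NormedSpace ℝ E]
  [IsScalarTower ℝ ℂ E]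

/-- The real basis `b, i b` obtained from a complex basis `b`. -/
def Module.Basis.realOfComplex {κ : Type*} (b : Module.Basis κ ℂ E) : Module.Basis (κ ⊕ κ) ℝ E :=
  (Complex.basisOneI.smulTower b).reindex
    ((finTwoEquiv.prodCongr (Equiv.refl κ)).trans (Equiv.boolProdEquivSum κ))

theorem Module.Basis.coe_realOfComplex {κ : Type*} (b : Module.Basis κ ℂ E) :
    (b.realOfComplex : κ ⊕ κ → E) = Sum.elim b fun k => Complex.I • b k := by
  have h0 : finTwoEquiv.symm false = 0 := rfl
  have h1 : finTwoEquiv.symm true = 1 := rfl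
  funext k
  rcases k with k | k
  · simp [Module.Basis.realOfComplex, Equiv.boolProdEquivSum, h0]
  · simp [Module.Basis.realOfComplex, Equiv.boolProdEquivSum, h1]

/-- The weights can be read off from a complex basis of simultaneous eigenvectors. -/
theorem isWeightMultiset_of_basis {M : Type*} [TopologicalSpace M] [ChartedSpace E M]
    [IsManifold 𝓘(ℂ, E) ω M] [IsManifold 𝓘(ℝ, E) ∞ M] {n : ℕ} {ρ : Torus n →* Equiv.Perm M} {x : M}
    {κ : Type*} [Fintype κ] (b : Module.Basis κ ℂ E) (w : κ → Fin n → ℤ) (hw : ∀ k, w k ≠ 0)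
    (h : ∀ g k, (mfderiv 𝓘(ℝ, E) 𝓘(ℝ, E) (ρ g) x (b k) : E) = (Torus.char (w k) g : ℂ) • b k) :
    IsWeightMultiset (complexStructure (E := E) (M := M)) ρ x (Finset.univ.val.map w) := by
  let e : Fin (Fintype.card κ) ≃ κ := (Fintype.equivFin κ).symm
  let b' := b.reindex e.symm
  have hb' : ∀ i, b' i = b (e i) := fun i => by simp [b']
  have hlin : LinearIndependent ℝ (Sum.elim b' fun k => Complex.I • b' k) :=
    b'.coe_realOfComplex ▸ b'.realOfComplex.linearIndependent
  have hspan : Submodule.span ℝ (Set.range (Sum.elim b' fun k => Complex.I • b' k)) = ⊤ :=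
    b'.coe_realOfComplex ▸ b'.realOfComplex.span_eq
  refine ⟨Fintype.card κ, fun i => w (e i), b', hlin, hspan, fun g i => ?_, fun i => hw _, ?_⟩
  · have hre : ∀ (z : ℂ) (v : E), z • v = z.re • v + z.im • Complex.I • v := by
      intro z v
      rw [← algebraMap_smul ℂ z.re v, ← algebraMap_smul ℂ z.im (Complex.I • v), smul_smul,
        ← add_smul]
      exact congrArg (· • v) (Complex.re_add_im z).symm
    refine Eq.trans ?_ (hre (Torus.char (w (e i)) g) (b' i))
    rw [hb']
    exact h g (e i)
  · have : (Finset.univ : Finset κ) = Finset.univ.map e.toEmbedding := by simp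
    rw [this, Finset.map_val, Multiset.map_map]
    rfl

end RealBasis

namespace SplitBundle

variable {p q r m : ℕ} (D : SplitBundle p q r m)

/-! ## Torus actions -/

section Action

variable (χ : Fin (p + 1) → Fin r → ℤ) (φ : Fin (q + 1) → Fin r → ℤ)

/-- The character through which the torus acts on the `j`-th line bundle over the `i`-th fixed point
of the base. -/
def lineWeight (j : Fin (q + 1)) (i : Fin (p + 1)) : Fin r → ℤ := φ j + D.d j • χ i

/-- The action `ρ` is given by `g · (w, s) = (g^χ w, g^φ s)` in homogeneous coordinates. -/
def IsDiagonal (ρ : Torus r →* Equiv.Perm D.carrier) : Prop :=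
  ∀ (g : Torus r) (w : Fin (p + 1) → ℂ) (s : Fin (q + 1) → ℂ) (hw : w ≠ 0) (hs : s ≠ 0),
    ρ g (D.point w s hw hs) =
      D.point (fun i => (Torus.char (χ i) g : ℂ) * w i) (fun j => (Torus.char (φ j) g : ℂ) * s j)
        (CP.diag_mk_ne_zero (fun i => Torus.char (χ i) g) hw)
        (CP.diag_mk_ne_zero (fun j => Torus.char (φ j) g) hs)

theorem homog_char_mul (g : Torus r) (w : Fin (p + 1) → ℂ) (s : Fin (q + 1) → ℂ) (c : Fin (m + 1)) :
    D.homog (fun i => (Torus.char (χ i) g : ℂ) * w i) (fun j => (Torus.char (φ j) g : ℂ) * s j) c =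
      Torus.char (D.lineWeight χ φ (D.σ c) (D.τ c)) g * D.homog w s c := by
  simp only [homog, lineWeight, Torus.char_add, Torus.char_nsmul, Circle.coe_mul, Circle.coe_pow]
  ring

theorem isDiagonal_of_ambient {ρ : Torus r →* Equiv.Perm D.carrier}
    (h : ∀ g x, (ρ g x).1 =
      (CP.torusAction (fun c => D.lineWeight χ φ (D.σ c) (D.τ c)) g x.1.1,
        CP.torusAction χ g x.1.2)) : D.IsDiagonal χ φ ρ := by
  intro g w s hw hs
  refine Subtype.ext ((h g _).trans (Prod.ext ?_ rfl))
  refine (CP.diag_mk _ _ _).trans ?_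
  congr 1
  exact funext fun c => (D.homog_char_mul χ φ g w s c).symm

/-- The weights at the `(i, j)`-th fixed point. -/
def weight (ij : Fin (p + 1) × Fin (q + 1)) : Fin p ⊕ Fin q → Fin r → ℤ :=
  Sum.elim (fun a => χ (ij.1.succAbove a) - χ ij.1)
    (fun b => D.lineWeight χ φ (ij.2.succAbove b) ij.1 - D.lineWeight χ φ ij.2 ij.1)

variable {χ φ} {ρ : Torus r →* Equiv.Perm D.carrier} (hρ : D.IsDiagonal χ φ ρ)

include hρ

theorem mem_domain_action (ij : Fin (p + 1) × Fin (q + 1)) (g : Torus r) (x : D.carrier) :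
    ρ g x ∈ D.domain ij ↔ x ∈ D.domain ij := by
  obtain ⟨w, s, hw, hs, rfl⟩ := D.exists_eq_point x
  rw [hρ, point_mem_domain, point_mem_domain]
  simp

theorem index_action (g : Torus r) (x : D.carrier) : D.index (ρ g x) = D.index x :=
  D.index_congr fun ij => D.mem_domain_action hρ ij g x

/-- Affine coordinates are quotients of coordinates on which the torus acts by characters, so each
is scaled by the difference of two characters. -/
theorem coords_action (ij : Fin (p + 1) × Fin (q + 1)) (g : Torus r) (x : D.carrier) :
    D.coords ij (ρ g x) =
      (fun a => (Torus.char (D.weight χ φ ij (Sum.inl a)) g : ℂ) * (D.coords ij x).1 a,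
        fun b => (Torus.char (D.weight χ φ ij (Sum.inr b)) g : ℂ) * (D.coords ij x).2 b) := by
  obtain ⟨w, s, hw, hs, rfl⟩ := D.exists_eq_point x
  rw [hρ, coords_point, coords_point]
  refine Prod.ext (funext fun a => ?_) (funext fun b => ?_)
  · simp only [weight, Sum.elim_inl, Torus.char_sub, Circle.coe_div]
    rw [div_mul_div_comm]
  · simp only [weight, lineWeight, Sum.elim_inr, Torus.char_sub, Torus.char_add, Torus.char_nsmul,
      Circle.coe_div, Circle.coe_mul, Circle.coe_pow]
    rw [div_mul_div_comm, mul_pow, mul_pow, mul_mul_mul_comm, mul_mul_mul_comm _ (s ij.2)]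

variable (χ φ) in
omit hρ in
/-- The action in the coordinates around the `(i, j)`-th fixed point. -/
def linearAction (ij : Fin (p + 1) × Fin (q + 1)) (g : Torus r) : (Fin r → ℂ) →L[ℂ] (Fin r → ℂ) :=
  D.modelEquiv.toContinuousLinearMap.comp
    (((ContinuousLinearMap.pi fun a => (Torus.char (D.weight χ φ ij (Sum.inl a)) g : ℂ) •
        ContinuousLinearMap.proj (R := ℂ) (φ := fun _ : Fin p => ℂ) a).prodMap
      (ContinuousLinearMap.pi fun b => (Torus.char (D.weight χ φ ij (Sum.inr b)) g : ℂ) •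
        ContinuousLinearMap.proj (R := ℂ) (φ := fun _ : Fin q => ℂ) b)).comp
      D.modelEquiv.symm.toContinuousLinearMap)

omit hρ in
theorem linearAction_modelEquiv (ij : Fin (p + 1) × Fin (q + 1)) (g : Torus r)
    (y : (Fin p → ℂ) × (Fin q → ℂ)) :
    D.linearAction χ φ ij g (D.modelEquiv y) =
      D.modelEquiv (fun a => (Torus.char (D.weight χ φ ij (Sum.inl a)) g : ℂ) * y.1 a,
        fun b => (Torus.char (D.weight χ φ ij (Sum.inr b)) g : ℂ) * y.2 b) := by
  change D.modelEquiv (_ : (Fin p → ℂ) × (Fin q → ℂ)) = _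
  congr 1
  change ((fun a => _ * (D.modelEquiv.symm (D.modelEquiv y)).1 a),
    fun b => _ * (D.modelEquiv.symm (D.modelEquiv y)).2 b) = _
  rw [ContinuousLinearEquiv.symm_apply_apply]

theorem chart_action (ij : Fin (p + 1) × Fin (q + 1)) (g : Torus r) (x : D.carrier) :
    D.chart ij (ρ g x) = D.linearAction χ φ ij g (D.chart ij x) := by
  rw [chart_apply, chart_apply, D.coords_action hρ, linearAction_modelEquiv]

theorem action_eq (ij : Fin (p + 1) × Fin (q + 1)) (g : Torus r) {x : D.carrier}
    (hx : x ∈ D.domain ij) :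
    ρ g x = (D.chart ij).symm (D.linearAction χ φ ij g (D.chart ij x)) := by
  rw [← D.chart_action hρ, (D.chart ij).left_inv]
  exact (D.mem_domain_action hρ ij g x).2 hx

theorem continuous_action (g : Torus r) : Continuous (ρ g) := by
  refine continuous_iff_continuousAt.2 fun x => ?_
  have hdom := (D.isOpen_domain (D.index x)).mem_nhds (D.mem_domain_index x)
  have h : ContinuousAt (fun x' => (D.chart (D.index x)).symm
      (D.linearAction χ φ (D.index x) g (D.chart (D.index x) x'))) x := by
    refine ((D.chart (D.index x)).continuousAt_symm (Set.mem_univ _)).comp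
      ((D.linearAction χ φ (D.index x) g).continuous.continuousAt.comp ?_)
    exact (D.chart (D.index x)).continuousAt (D.mem_domain_index x)
  refine h.congr ?_
  filter_upwards [hdom] with x' hx'
  exact (D.action_eq hρ _ g hx').symm

/-- The points `x` and `ρ g x` have the same preferred chart, in which the action is linear and so
its own derivative. This holds at all points, not only at fixed ones. -/
theorem hasMFDerivAt_action (g : Torus r) (x : D.carrier) :
    HasMFDerivAt 𝓘(ℝ, Fin r → ℂ) 𝓘(ℝ, Fin r → ℂ) (ρ g) x
      ((D.linearAction χ φ (D.index x) g).restrictScalars ℝ) := by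
  refine ⟨(D.continuous_action hρ g).continuousAt, ?_⟩
  have h : writtenInExtChartAt 𝓘(ℝ, Fin r → ℂ) 𝓘(ℝ, Fin r → ℂ) x (ρ g) =
      (D.linearAction χ φ (D.index x) g).restrictScalars ℝ := by
    funext y
    simp only [writtenInExtChartAt, mfld_simps, chartAt_eq, D.index_action hρ]
    rw [D.chart_action hρ, (D.chart _).right_inv (Set.mem_univ y)]
    rfl
  rw [h]
  exact ((D.linearAction χ φ (D.index x) g).restrictScalars ℝ).hasFDerivWithinAt

theorem mfderiv_action (g : Torus r) (x : D.carrier) (v : Fin r → ℂ) :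
    (mfderiv 𝓘(ℝ, Fin r → ℂ) 𝓘(ℝ, Fin r → ℂ) (ρ g) x v : Fin r → ℂ) =
      D.linearAction χ φ (D.index x) g v := by
  rw [(D.hasMFDerivAt_action hρ g x).mfderiv]
  rfl

omit hρ in
theorem contDiff_linearAction (ij : Fin (p + 1) × Fin (q + 1)) :
    ContDiff ℝ ∞ fun y : (Fin r → ℝ) × (Fin r → ℂ) =>
      D.linearAction χ φ ij (Torus.exp y.1) y.2 := by
  have hL : ContDiff ℝ ∞ D.modelEquiv := D.modelEquiv.contDiff.restrict_scalars ℝ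
  have hL' : ContDiff ℝ ∞ fun y : (Fin r → ℝ) × (Fin r → ℂ) => D.modelEquiv.symm y.2 :=
    (D.modelEquiv.symm.contDiff.restrict_scalars ℝ).comp contDiff_snd
  have hc : ∀ v : Fin r → ℤ, ContDiff ℝ ∞ fun y : (Fin r → ℝ) × (Fin r → ℂ) =>
      (Torus.char v (Torus.exp y.1) : ℂ) := fun v => (Torus.contDiff_char_exp v).comp contDiff_fst
  refine hL.comp (ContDiff.prodMk (contDiff_pi.2 fun a => ?_) (contDiff_pi.2 fun b => ?_))
  · exact (hc _).mul ((contDiff_apply ℝ ℂ a).comp (contDiff_fst.comp hL'))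
  · exact (hc _).mul ((contDiff_apply ℝ ℂ b).comp (contDiff_snd.comp hL'))

theorem contMDiff_action :
    ContMDiff (𝓘(ℝ, Fin r → ℝ).prod 𝓘(ℝ, Fin r → ℂ)) 𝓘(ℝ, Fin r → ℂ) ∞
      (fun y : (Fin r → ℝ) × D.carrier => ρ (Torus.exp y.1) y.2) := by
  rintro ⟨θ, x⟩
  let c := D.chart (D.index x)
  have hmem : c ∈ IsManifold.maximalAtlas 𝓘(ℝ, Fin r → ℂ) ∞ D.carrier :=
    (contDiffGroupoid ∞ 𝓘(ℝ, Fin r → ℂ)).subset_maximalAtlas ⟨_, rfl⟩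
  have h1 : ContMDiff 𝓘(ℝ, Fin r → ℂ) 𝓘(ℝ, Fin r → ℂ) ∞ c.symm :=
    contMDiffOn_univ.1 (contMDiffOn_symm_of_mem_maximalAtlas hmem)
  have h2 := (D.contDiff_linearAction (χ := χ) (φ := φ) (D.index x)).contMDiff
  have h3 : ContMDiffAt 𝓘(ℝ, Fin r → ℂ) 𝓘(ℝ, Fin r → ℂ) ∞ c x :=
    (contMDiffOn_of_mem_maximalAtlas hmem).contMDiffAt
      ((D.isOpen_domain _).mem_nhds (D.mem_domain_index x))
  have h4 : ContMDiffAt (𝓘(ℝ, Fin r → ℝ).prod 𝓘(ℝ, Fin r → ℂ))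
      𝓘(ℝ, (Fin r → ℝ) × (Fin r → ℂ)) ∞
      (fun y : (Fin r → ℝ) × D.carrier => (y.1, c y.2)) (θ, x) :=
    contMDiffAt_fst.prodMk_space (h3.comp (θ, x) contMDiffAt_snd)
  refine (h1.contMDiffAt.comp (θ, x) (h2.contMDiffAt.comp (θ, x) h4)).congr_of_eventuallyEq ?_
  filter_upwards [continuousAt_snd.preimage_mem_nhds
    ((D.isOpen_domain _).mem_nhds (D.mem_domain_index x))] with y hy
  exact D.action_eq hρ _ _ hy

end Action

end SplitBundle

namespace SplitBundle

variable {p q r m : ℕ} (D : SplitBundle p q r m)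

/-! ## Fixed points, weights and invariant spheres -/

/-- The point all of whose homogeneous coordinates except `w_i` and `s_j` vanish. -/
def fixedPt (ij : Fin (p + 1) × Fin (q + 1)) : D.carrier :=
  D.point (Pi.single ij.1 1) (Pi.single ij.2 1) (by simp) (by simp)

theorem fixedPt_mem_domain (ij kl : Fin (p + 1) × Fin (q + 1)) :
    D.fixedPt ij ∈ D.domain kl ↔ kl = ij := by
  rw [fixedPt, point_mem_domain, Prod.ext_iff]
  simp [Pi.single_apply]

theorem index_fixedPt (ij : Fin (p + 1) × Fin (q + 1)) : D.index (D.fixedPt ij) = ij :=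
  (D.fixedPt_mem_domain _ _).1 (D.mem_domain_index _)

theorem fixedPt_injective : Function.Injective D.fixedPt := fun ij kl h => by
  rw [← D.index_fixedPt ij, h, D.index_fixedPt]

theorem coords_fixedPt (ij : Fin (p + 1) × Fin (q + 1)) : D.coords ij (D.fixedPt ij) = 0 := by
  rw [fixedPt, coords_point]
  refine Prod.ext (funext fun a => ?_) (funext fun b => ?_)
  · simp
  · simp

theorem eq_fixedPt {ij : Fin (p + 1) × Fin (q + 1)} {x : D.carrier} (hx : x ∈ D.domain ij)
    (h : D.coords ij x = 0) : x = D.fixedPt ij := by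
  rw [← D.ofCoords_coords hx, h, ← D.coords_fixedPt ij,
    D.ofCoords_coords ((D.fixedPt_mem_domain _ _).2 rfl)]

section Action

variable {χ : Fin (p + 1) → Fin r → ℤ} {φ : Fin (q + 1) → Fin r → ℤ}
  {ρ : Torus r →* Equiv.Perm D.carrier} (hρ : D.IsDiagonal χ φ ρ)

include hρ

theorem action_fixedPt (g : Torus r) (ij : Fin (p + 1) × Fin (q + 1)) :
    ρ g (D.fixedPt ij) = D.fixedPt ij := by
  refine D.eq_fixedPt ((D.mem_domain_action hρ _ _ _).2 ((D.fixedPt_mem_domain _ _).2 rfl)) ?_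
  rw [D.coords_action hρ, coords_fixedPt]
  refine Prod.ext (funext fun a => ?_) (funext fun b => ?_) <;> simp

/-- In a chart around a fixed point every coordinate is invariant under a nontrivial character and
hence zero, so the point is the origin of the chart. -/
theorem fixedSet_eq_range (hw : ∀ ij k, D.weight χ φ ij k ≠ 0) :
    fixedSet ρ Set.univ = Set.range D.fixedPt := by
  ext x
  constructor
  · intro hx
    refine ⟨D.index x, (D.eq_fixedPt (D.mem_domain_index x) ?_).symm⟩
    have hc : ∀ g, D.coords (D.index x) x = _ := fun g =>
      (congrArg _ (hx g (Set.mem_univ g))).symm.trans (D.coords_action hρ (D.index x) g x)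
    have hz : ∀ (v : Fin r → ℤ) (z : ℂ), v ≠ 0 → (∀ g, z = (Torus.char v g : ℂ) * z) → z = 0 := by
      intro v z hv h
      by_contra hz
      obtain ⟨g, hg⟩ := Torus.exists_char_ne_one hv
      have h1 := mul_right_cancel₀ hz ((one_mul z).trans (h g))
      exact hg (Circle.coe_eq_one.1 h1.symm)
    refine Prod.ext (funext fun a => ?_) (funext fun b => ?_)
    · exact hz _ _ (hw (D.index x) (Sum.inl a)) fun g => congrFun (congrArg Prod.fst (hc g)) a
    · exact hz _ _ (hw (D.index x) (Sum.inr b)) fun g => congrFun (congrArg Prod.snd (hc g)) b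
  · rintro ⟨ij, rfl⟩ g -
    exact D.action_fixedPt hρ g ij

theorem isAlmostComplexTorusManifold {ij : Fin (p + 1) × Fin (q + 1)}
    (heff : ∀ g, (∀ k, Torus.char (D.weight χ φ ij k) g = 1) → g = 1) :
    IsAlmostComplexTorusManifold r (complexStructure (E := Fin r → ℂ) (M := D.carrier)) ρ where
  finiteDimensional := inferInstance
  finrank_eq := by
    simp [Module.finrank_pi_fintype, Complex.finrank_real_complex, mul_comm]
  t2 := inferInstance
  compact := inferInstance
  connected := inferInstance
  smooth_action := D.contMDiff_action hρ
  preserves_J g x := fun v : Fin r → ℂ => by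
    refine (D.mfderiv_action hρ g x (Complex.I • v)).trans ?_
    rw [map_smul]
    exact congrArg (Complex.I • ·) (D.mfderiv_action hρ g x v).symm
  effective := by
    rw [injective_iff_map_eq_one]
    intro g hg
    refine heff g fun k => ?_
    -- If `g` fixes the point with all affine coordinates equal to one, then every weight of this
    -- chart is trivial on `g`.
    have h := D.coords_action hρ ij g (D.ofCoords ij (fun _ => 1, fun _ => 1))
    rw [hg, Equiv.Perm.one_apply, coords_ofCoords] at h
    rcases k with a | b
    · simpa [Circle.coe_eq_one] using (congrFun (congrArg Prod.fst h) a).symm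
    · simpa [Circle.coe_eq_one] using (congrFun (congrArg Prod.snd h) b).symm
  exists_fixed := ⟨D.fixedPt ij, fun g _ => D.action_fixedPt hρ g ij⟩

omit hρ in
/-- The basis of the tangent spaces given by the affine coordinates. -/
def modelBasis : Module.Basis (Fin p ⊕ Fin q) ℂ (Fin r → ℂ) :=
  ((Pi.basisFun ℂ (Fin p)).prod (Pi.basisFun ℂ (Fin q))).map D.modelEquiv.toLinearEquiv

omit hρ in
theorem linearAction_modelBasis (ij : Fin (p + 1) × Fin (q + 1)) (g : Torus r)
    (k : Fin p ⊕ Fin q) : D.linearAction χ φ ij g (D.modelBasis k) =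
      (Torus.char (D.weight χ φ ij k) g : ℂ) • D.modelBasis k := by
  have hb : D.modelBasis k =
      D.modelEquiv (((Pi.basisFun ℂ (Fin p)).prod (Pi.basisFun ℂ (Fin q))) k) := rfl
  rw [hb, linearAction_modelEquiv, ← map_smul]
  congr 1
  rcases k with k | k
  · refine Prod.ext (funext fun a => ?_) (funext fun b => ?_)
    · by_cases h : a = k
      · simp [h]
      · simp [h]
    · simp
  · refine Prod.ext (funext fun a => ?_) (funext fun b => ?_)
    · simp
    · by_cases h : b = k
      · simp [h]
      · simp [h]

theorem isWeightMultiset_fixedPt (hw : ∀ ij k, D.weight χ φ ij k ≠ 0)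
    (ij : Fin (p + 1) × Fin (q + 1)) :
    IsWeightMultiset (complexStructure (E := Fin r → ℂ) (M := D.carrier)) ρ (D.fixedPt ij)
      (Finset.univ.val.map (D.weight χ φ ij)) := by
  refine isWeightMultiset_of_basis D.modelBasis _ (hw ij) fun g k => ?_
  rw [← D.linearAction_modelBasis]
  refine (D.mfderiv_action hρ g _ (D.modelBasis k)).trans ?_
  rw [index_fixedPt]

omit hρ in
/-- A family of points parametrized by the nonzero vectors of `ℂ²` connects its members. -/
theorem mem_connectedComponentIn_of_family {F : Set D.carrier}
    (w : (Fin 2 → ℂ) → Fin (p + 1) → ℂ) (s : (Fin 2 → ℂ) → Fin (q + 1) → ℂ)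
    (hw : ∀ y ≠ 0, w y ≠ 0) (hs : ∀ y ≠ 0, s y ≠ 0) (hwc : Continuous w) (hsc : Continuous s)
    (hF : ∀ y (hy : y ≠ 0), D.point (w y) (s y) (hw y hy) (hs y hy) ∈ F) {y y' : Fin 2 → ℂ}
    (hy : y ≠ 0) (hy' : y' ≠ 0) :
    D.point (w y') (s y') (hw y' hy') (hs y' hy') ∈
      connectedComponentIn F (D.point (w y) (s y) (hw y hy) (hs y hy)) := by
  have : ConnectedSpace ({0}ᶜ : Set (Fin 2 → ℂ)) :=
    isConnected_iff_connectedSpace.1 (isConnected_compl_zero 1)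
  let f (v : ({0}ᶜ : Set (Fin 2 → ℂ))) : D.carrier :=
    D.point (w v) (s v) (hw v v.2) (hs v v.2)
  have hc : Continuous f := D.continuous_point _ _ (hwc.comp continuous_subtype_val)
    (hsc.comp continuous_subtype_val)
  refine (isPreconnected_range hc).subset_connectedComponentIn ⟨⟨y, hy⟩, rfl⟩ ?_ ⟨⟨y', hy'⟩, rfl⟩
  rintro _ ⟨v, rfl⟩
  exact hF v v.2

omit hρ in
/-- The vector with entries `y₀` and `y₁` at the places `i` and `i'`. -/
def twoEntries {n : ℕ} (i i' : Fin n) (y : Fin 2 → ℂ) : Fin n → ℂ :=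
  Pi.single i (y 0) + Pi.single i' (y 1)

omit hρ in
theorem twoEntries_ne_zero {n : ℕ} {i i' : Fin n} (h : i ≠ i') (y : Fin 2 → ℂ) (hy : y ≠ 0) :
    twoEntries i i' y ≠ 0 := by
  intro h0
  refine hy (funext fun k => ?_)
  fin_cases k
  · simpa [twoEntries, h] using congrFun h0 i
  · simpa [twoEntries, h.symm] using congrFun h0 i'

omit hρ in
theorem continuous_twoEntries {n : ℕ} (i i' : Fin n) : Continuous (twoEntries i i') :=
  ((continuous_single i).comp (continuous_apply 0)).add
    ((continuous_single i').comp (continuous_apply 1))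

omit hρ in
theorem twoEntries_of_ne {n : ℕ} {i i' a : Fin n} (y : Fin 2 → ℂ) (h : a ≠ i) (h' : a ≠ i') :
    twoEntries i i' y a = 0 := by
  simp [twoEntries, h, h']

/-- On the projective line with `w` supported on `{i, i'}` and `s` on `{j}`, an element with `g^{χ
i} = g^{χ i'}` acts by scalars on `w` and on `s`, hence trivially. -/
theorem fixedPt_mem_component_base {i i' : Fin (p + 1)} (h : i ≠ i') (j : Fin (q + 1)) :
    D.fixedPt (i', j) ∈ connectedComponentIn (fixedSet ρ {g | Torus.char (χ i' - χ i) g = 1})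
      (D.fixedPt (i, j)) := by
  have key := D.mem_connectedComponentIn_of_family
    (F := fixedSet ρ {g | Torus.char (χ i' - χ i) g = 1})
    (twoEntries i i') (fun _ => Pi.single j 1) (twoEntries_ne_zero h)
    (fun _ _ => by simp) (continuous_twoEntries i i') continuous_const ?_
    (y := ![1, 0]) (y' := ![0, 1]) (by simp) (by simp)
  · simpa [twoEntries, fixedPt] using key
  · intro y hy g hg
    have hg' : Torus.char (χ i') g = Torus.char (χ i) g := by
      rw [Set.mem_ofPred_eq, Torus.char_sub, div_eq_one] at hg
      exact hg
    rw [hρ]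
    refine D.point_eq_point (Torus.char (χ i) g)
      ((Torus.char (χ i) g : ℂ) ^ D.d j * Torus.char (φ j) g) (fun a => ?_) fun b => ?_
    · by_cases ha : a = i
      · rw [ha]
      · by_cases ha' : a = i'
        · rw [ha', hg']
        · rw [twoEntries_of_ne y ha ha', mul_zero, mul_zero]
    · by_cases hb : b = j
      · rw [hb]
        ring
      · simp [hb]

/-- The line now lies in the fibre over the `i`-th fixed point. Rescaling `w` back by `χ i` adds
`d_j χ_i` to the character of `s_j`, which is why line weights occur instead of `φ`. -/
theorem fixedPt_mem_component_fiber {j j' : Fin (q + 1)} (h : j ≠ j') (i : Fin (p + 1)) :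
    D.fixedPt (i, j') ∈ connectedComponentIn
      (fixedSet ρ {g | Torus.char (D.lineWeight χ φ j' i - D.lineWeight χ φ j i) g = 1})
      (D.fixedPt (i, j)) := by
  have key := D.mem_connectedComponentIn_of_family
    (F := fixedSet ρ {g | Torus.char (D.lineWeight χ φ j' i - D.lineWeight χ φ j i) g = 1})
    (fun _ => Pi.single i 1) (twoEntries j j') (fun _ _ => by simp) (twoEntries_ne_zero h)
    continuous_const (continuous_twoEntries j j') ?_
    (y := ![1, 0]) (y' := ![0, 1]) (by simp) (by simp)
  · simpa [twoEntries, fixedPt] using key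
  · intro y hy g hg
    have hg' : Torus.char (D.lineWeight χ φ j' i) g = Torus.char (D.lineWeight χ φ j i) g := by
      rw [Set.mem_ofPred_eq, Torus.char_sub, div_eq_one] at hg
      exact hg
    have hl : ∀ b, (Torus.char (χ i) g : ℂ) ^ D.d b * Torus.char (φ b) g =
        Torus.char (D.lineWeight χ φ b i) g := fun b => by
      rw [lineWeight, Torus.char_add, Torus.char_nsmul, mul_comm, Circle.coe_mul, Circle.coe_pow]
    rw [hρ]
    refine D.point_eq_point (Torus.char (χ i) g) (Torus.char (D.lineWeight χ φ j i) g)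
      (fun a => ?_) fun b => ?_
    · by_cases ha : a = i
      · rw [ha]
      · simp [ha]
    · rw [← mul_assoc, hl]
      by_cases hb : b = j
      · rw [hb]
      · by_cases hb' : b = j'
        · rw [hb', hg']
        · rw [twoEntries_of_ne y hb hb', mul_zero, mul_zero]

end Action

/-- The label of an oriented edge of the graph of the bundle: two fixed points over the same fixed
point of the base, or on the same section, are joined by an edge. -/
def IsEdgeLabel (χ : Fin (p + 1) → Fin r → ℤ) (φ : Fin (q + 1) → Fin r → ℤ)
    (ij kl : Fin (p + 1) × Fin (q + 1)) (v : Fin r → ℤ) : Prop :=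
  (ij.1 ≠ kl.1 ∧ ij.2 = kl.2 ∧ v = χ kl.1 - χ ij.1) ∨
    (ij.1 = kl.1 ∧ ij.2 ≠ kl.2 ∧ v = D.lineWeight χ φ kl.2 ij.1 - D.lineWeight χ φ ij.2 ij.1)

/-- Reduces the geometric claim to combinatorics: matching lists of weights, and edges that are
invariant lines in a fibre or in a coordinate section. -/
theorem describes {χ : Fin (p + 1) → Fin r → ℤ} {φ : Fin (q + 1) → Fin r → ℤ}
    {ρ : Torus r →* Equiv.Perm D.carrier} (hρ : D.IsDiagonal χ φ ρ)
    (hw : ∀ ij k, D.weight χ φ ij k ≠ 0) {Vert Edge : Type} [DecidableEq Vert] [Fintype Edge]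
    (Γ : LabeledMultigraph r Vert Edge) (V : Vert ≃ Fin (p + 1) × Fin (q + 1))
    (hW : ∀ v, ((Finset.univ.filter fun e => Γ.i e = v).val.map Γ.label +
      (Finset.univ.filter fun e => Γ.t e = v).val.map fun e => -Γ.label e) =
        Finset.univ.val.map (D.weight χ φ (V v)))
    (hE : ∀ e, D.IsEdgeLabel χ φ (V (Γ.i e)) (V (Γ.t e)) (Γ.label e)) :
    Describes Γ (complexStructure (E := Fin r → ℂ) (M := D.carrier)) ρ := by
  refine ⟨fun v => D.fixedPt (V v), ?_, D.fixedPt_injective.comp V.injective, ?_, fun v => ?_,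
    fun e => ?_⟩
  · rw [D.fixedSet_eq_range hρ hw]
    have : Finite (Set.range D.fixedPt) := Set.finite_range _
    infer_instance
  · rw [D.fixedSet_eq_range hρ hw]
    exact V.surjective.range_comp D.fixedPt
  · rw [hW]
    exact D.isWeightMultiset_fixedPt hρ hw _
  · have h := hE e
    generalize V (Γ.i e) = ij at h ⊢
    generalize V (Γ.t e) = kl at h ⊢
    obtain ⟨i, j⟩ := ij
    obtain ⟨i', j'⟩ := kl
    simp only [IsEdgeLabel] at h
    obtain ⟨hi, rfl, hl⟩ | ⟨rfl, hj, hl⟩ := h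
    · rw [hl]
      exact D.fixedPt_mem_component_base hρ hi j
    · rw [hl]
      exact D.fixedPt_mem_component_fiber hρ hj i

theorem submanifoldDescribedBy {D : SplitBundle p q 3 m} {χ : Fin (p + 1) → Fin 3 → ℤ}
    {φ : Fin (q + 1) → Fin 3 → ℤ} {S : Set (CP m × CP p)} (hS : S = D.carrier)
    {ρ : Torus 3 →* Equiv.Perm S}
    (hρ : ∀ g x, (ρ g x).1 =
      (CP.torusAction (fun c => D.lineWeight χ φ (D.σ c) (D.τ c)) g x.1.1,
        CP.torusAction χ g x.1.2))
    (hpq : ((p : ℤ) + 1) * (q + 1) = 6) (hw : ∀ ij k, D.weight χ φ ij k ≠ 0)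
    {ij : Fin (p + 1) × Fin (q + 1)}
    (heff : ∀ g, (∀ k, Torus.char (D.weight χ φ ij k) g = 1) → g = 1)
    {Vert Edge : Type} [DecidableEq Vert] [Fintype Edge]
    (Γ : LabeledMultigraph 3 Vert Edge) (V : Vert ≃ Fin (p + 1) × Fin (q + 1))
    (hW : ∀ v, ((Finset.univ.filter fun e => Γ.i e = v).val.map Γ.label +
      (Finset.univ.filter fun e => Γ.t e = v).val.map fun e => -Γ.label e) =
        Finset.univ.val.map (D.weight χ φ (V v)))
    (hE : ∀ e, D.IsEdgeLabel χ φ (V (Γ.i e)) (V (Γ.t e)) (Γ.label e)) :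
    SubmanifoldDescribedBy S ρ Γ := by
  subst hS
  have hρ' := D.isDiagonal_of_ambient χ φ hρ
  exact ⟨inferInstance, inferInstance, inferInstance, complexStructure, D.isSmoothEmbedding_val,
    complexStructure_apply, D.isAlmostComplexTorusManifold hρ' heff, hpq ▸ D.hasEulerNumber,
    D.describes hρ' hw Γ V hW hE⟩

end SplitBundle

theorem SubmanifoldDescribedBy.describesSomeManifold {m n : ℕ} {S : Set (CP m × CP n)}
    {ρ : Torus 3 →* Equiv.Perm S} {Vert Edge : Type} [DecidableEq Vert] [Fintype Edge]
    {Γ : LabeledMultigraph 3 Vert Edge} (h : SubmanifoldDescribedBy S ρ Γ) :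
    DescribesSomeManifold Γ := by
  obtain ⟨_, _, _, J, -, -, h⟩ := h
  exact ⟨S, _, _, _, J, ρ, h⟩

/-! ### Weights through differences of degrees, and the incidence lists of the graphs -/

namespace SplitBundle

variable {m : ℕ}

theorem weight_ne_zero {p q r m : ℕ} (D : SplitBundle p q r m) {χ : Fin (p + 1) → Fin r → ℤ}
    {φ : Fin (q + 1) → Fin r → ℤ} (hχ : Function.Injective χ)
    (hl : ∀ i, Function.Injective fun j => D.lineWeight χ φ j i) (ij : Fin (p + 1) × Fin (q + 1))
    (k : Fin p ⊕ Fin q) : D.weight χ φ ij k ≠ 0 := by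
  rcases k with a | b
  · exact sub_ne_zero.2 (hχ.ne (Fin.succAbove_ne _ _))
  · exact sub_ne_zero.2 ((hl ij.1).ne (Fin.succAbove_ne _ _))

theorem map_weight {p q r m : ℕ} (D : SplitBundle p q r m) (χ : Fin (p + 1) → Fin r → ℤ)
    (φ : Fin (q + 1) → Fin r → ℤ) (ij : Fin (p + 1) × Fin (q + 1)) :
    Finset.univ.val.map (D.weight χ φ ij) =
      Finset.univ.val.map (fun a => χ (ij.1.succAbove a) - χ ij.1) +
      Finset.univ.val.map fun b =>
        D.lineWeight χ φ (ij.2.succAbove b) ij.1 - D.lineWeight χ φ ij.2 ij.1 := by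
  rw [← Finset.univ_disjSum_univ, Finset.val_disjSum, Multiset.disjSum, Multiset.map_add,
    Multiset.map_map, Multiset.map_map]
  rfl

/-- Only the difference of the degrees enters, so natural numbers as degrees suffice for graphs with
negative parameters. -/
theorem lineWeight_sub {p q r m : ℕ} (D : SplitBundle p q r m) (χ : Fin (p + 1) → Fin r → ℤ)
    (φ : Fin (q + 1) → Fin r → ℤ) (j j' : Fin (q + 1)) (i : Fin (p + 1)) :
    D.lineWeight χ φ j i - D.lineWeight χ φ j' i =
      φ j - φ j' + ((D.d j : ℤ) - D.d j') • χ i := by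
  simp only [lineWeight, sub_smul, natCast_zsmul]
  abel

/-- The initial vertices of the edges of the graphs of both types. -/
def edgeSource : Fin 9 → Fin 6 := ![1, 1, 0, 4, 4, 5, 0, 1, 2]

/-- The terminal vertices of the edges of the graphs of both types. -/
def edgeTarget : Fin 9 → Fin 6 := ![0, 2, 2, 5, 3, 3, 5, 4, 3]

/-- Both types of graphs have the same underlying directed graph, so the incidence lists are
computed once. -/
theorem filter_edgeSource (v : Fin 6) : (Finset.univ.filter fun e => edgeSource e = v).val =
    (![{2, 6}, {0, 1, 7}, {8}, 0, {3, 4}, {5}] : Fin 6 → Multiset (Fin 9)) v := by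
  decide +revert

theorem filter_edgeTarget (v : Fin 6) : (Finset.univ.filter fun e => edgeTarget e = v).val =
    (![{0}, 0, {1, 2}, {4, 5, 8}, {7}, {3, 6}] : Fin 6 → Multiset (Fin 9)) v := by
  decide +revert

/-! ## The graphs of type (a) -/

/-- The fixed points of a `ℂℙ¹`-bundle over `ℂℙ²` that are the vertices of a graph of type (a). -/
def vertexA : Fin 6 ≃ Fin (2 + 1) × Fin (1 + 1) where
  toFun := ![(1, 1), (0, 1), (2, 1), (2, 0), (0, 0), (1, 0)]
  invFun x := ![![4, 1], ![5, 0], ![3, 2]] x.1 x.2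
  left_inv := by decide
  right_inv := by decide

/-- The characters of the torus action on the base `ℂℙ²`. -/
def baseA (a b : Fin 3 → ℤ) : Fin (2 + 1) → Fin 3 → ℤ := ![0, a, a + b]

/-- The characters of the torus action on the two line bundles over `ℂℙ²`. -/
def fiberA (c : Fin 3 → ℤ) : Fin (1 + 1) → Fin 3 → ℤ := ![0, -c]

theorem baseA_zero (a b : Fin 3 → ℤ) : baseA a b 0 = 0 := by simp [baseA]

theorem baseA_one (a b : Fin 3 → ℤ) : baseA a b 1 = a := by simp [baseA]

theorem baseA_two (a b : Fin 3 → ℤ) : baseA a b 2 = a + b := by simp [baseA]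

section

variable {D : SplitBundle 2 1 3 m} {k : ℤ} (hd : (D.d 0 : ℤ) - D.d 1 = k) (a b c : Fin 3 → ℤ)

include hd

theorem lineWeight_sub_A (i : Fin 3) :
    D.lineWeight (baseA a b) (fiberA c) 0 i - D.lineWeight (baseA a b) (fiberA c) 1 i =
      c + k • baseA a b i := by
  rw [lineWeight_sub, hd]
  simp [fiberA]

theorem isEdgeLabel_graphA (e : Fin 9) :
    D.IsEdgeLabel (baseA a b) (fiberA c) (vertexA ((graphA a b c k).i e))
      (vertexA ((graphA a b c k).t e)) ((graphA a b c k).label e) := by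
  have h := lineWeight_sub_A hd a b c
  fin_cases e <;>
    simp [graphA, vertexA, IsEdgeLabel, baseA_zero, baseA_one, baseA_two, h, -zsmul_eq_mul]

theorem weights_graphA (v : Fin 6) :
    (Finset.univ.filter fun e => (graphA a b c k).i e = v).val.map (graphA a b c k).label +
      (Finset.univ.filter fun e => (graphA a b c k).t e = v).val.map
        (fun e => -(graphA a b c k).label e) =
      Finset.univ.val.map (D.weight (baseA a b) (fiberA c) (vertexA v)) := by
  have h := lineWeight_sub_A hd a b c
  have h' : ∀ i, D.lineWeight (baseA a b) (fiberA c) 1 i - D.lineWeight (baseA a b) (fiberA c) 0 i =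
    -(c + k • baseA a b i) := fun i => by rw [← h, neg_sub]
  have hu2 : (Finset.univ : Finset (Fin 2)).val = {0, 1} := rfl
  have hu1 : (Finset.univ : Finset (Fin 1)).val = {0} := rfl
  rw [map_weight, show (graphA a b c k).i = edgeSource from rfl,
    show (graphA a b c k).t = edgeTarget from rfl, filter_edgeSource, filter_edgeTarget]
  simp only [hu1, hu2]
  fin_cases v <;>
    simp [graphA, vertexA, baseA_zero, baseA_one, baseA_two, h, h', -zsmul_eq_mul,
      Fin.succAbove] <;>
    -- Only the order in which the weights are listed can still differ.
    simp only [← Multiset.singleton_add] <;> abel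

theorem describedBy_graphA (B : Module.Basis (Fin 3) ℤ (Fin 3 → ℤ)) {S : Set (CP m × CP 2)}
    (hS : S = D.carrier) {ρ : Torus 3 →* Equiv.Perm S}
    (hρ : ∀ g x, (ρ g x).1 =
      (CP.torusAction (fun c =>
          D.lineWeight (baseA (B 0) (B 1)) (fiberA (B 2)) (D.σ c) (D.τ c)) g x.1.1,
        CP.torusAction (baseA (B 0) (B 1)) g x.1.2)) :
    SubmanifoldDescribedBy S ρ (graphA (B 0) (B 1) (B 2) k) := by
  have h := lineWeight_sub_A hd (B 0) (B 1) (B 2)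
  have hχ : Function.Injective (baseA (B 0) (B 1)) := by
    intro i i' h
    have h0 : B.repr (baseA (B 0) (B 1) i) 0 = B.repr (baseA (B 0) (B 1) i') 0 := by rw [h]
    have h1 : B.repr (baseA (B 0) (B 1) i) 1 = B.repr (baseA (B 0) (B 1) i') 1 := by rw [h]
    fin_cases i <;> fin_cases i' <;> simp [baseA] at h0 h1 ⊢
  have hl : ∀ i, Function.Injective fun j =>
      D.lineWeight (baseA (B 0) (B 1)) (fiberA (B 2)) j i := by
    intro i
    have hi : B.repr (baseA (B 0) (B 1) i) 2 = 0 := by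
      fin_cases i <;> simp [baseA]
    have hii : D.lineWeight (baseA (B 0) (B 1)) (fiberA (B 2)) 0 i ≠
        D.lineWeight (baseA (B 0) (B 1)) (fiberA (B 2)) 1 i := by
      rw [← sub_ne_zero, h]
      intro h0
      have := congrArg (fun v => B.repr v 2) h0
      simp [hi, -zsmul_eq_mul] at this
    intro j j' hj
    fin_cases j <;> fin_cases j'
    · rfl
    · exact absurd hj hii
    · exact absurd hj.symm hii
    · rfl
  -- At this fixed point `χ` vanishes and the weights are `a`, `a + b`, `c`, which generate the
  -- lattice; this gives effectiveness.
  refine submanifoldDescribedBy hS hρ (by norm_num) (D.weight_ne_zero hχ hl) (ij := (0, 1))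
    (fun g hg => ?_) _ vertexA (weights_graphA hd _ _ _) (isEdgeLabel_graphA hd _ _ _)
  have ha : Torus.char (B 0) g = 1 := by
    simpa [weight, baseA] using hg (Sum.inl 0)
  have hab : Torus.char (B 0 + B 1) g = 1 := by
    simpa [weight, baseA] using hg (Sum.inl 1)
  have hc : Torus.char (B 2) g = 1 := by
    simpa [weight, h, baseA_zero, Fin.succAbove] using hg (Sum.inr 0)
  refine Torus.eq_one_of_char_basis B fun i => ?_
  fin_cases i
  · exact ha
  · simpa [Torus.char_add, ha] using hab
  · exact hc

end

/-! ## The graphs of type (b) -/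

/-- The fixed points of a `ℂℙ²`-bundle over `ℂℙ¹` that are the vertices of a graph of type (b). -/
def vertexB : Fin 6 ≃ Fin (1 + 1) × Fin (2 + 1) where
  toFun := ![(0, 0), (0, 1), (0, 2), (1, 2), (1, 1), (1, 0)]
  invFun x := ![![0, 1, 2], ![5, 4, 3]] x.1 x.2
  left_inv := by decide
  right_inv := by decide

/-- The characters of the torus action on the base `ℂℙ¹`. -/
def baseB (c : Fin 3 → ℤ) : Fin (1 + 1) → Fin 3 → ℤ := ![0, c]

/-- The characters of the torus action on the three line bundles over `ℂℙ¹`. -/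
def fiberB (a b : Fin 3 → ℤ) : Fin (2 + 1) → Fin 3 → ℤ := ![0, -a, b]

theorem baseB_zero (c : Fin 3 → ℤ) : baseB c 0 = 0 := by simp [baseB]

theorem baseB_one (c : Fin 3 → ℤ) : baseB c 1 = c := by simp [baseB]

section

variable {D : SplitBundle 1 2 3 m} {k l : ℤ} (hd : (D.d 0 : ℤ) - D.d 1 = k)
  (hd' : (D.d 2 : ℤ) - D.d 0 = l) (a b c : Fin 3 → ℤ)

include hd in
theorem lineWeight_sub_B01 (i : Fin 2) :
    D.lineWeight (baseB c) (fiberB a b) 0 i - D.lineWeight (baseB c) (fiberB a b) 1 i =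
      a + k • baseB c i := by
  rw [lineWeight_sub, hd]
  simp [fiberB]

include hd' in
theorem lineWeight_sub_B20 (i : Fin 2) :
    D.lineWeight (baseB c) (fiberB a b) 2 i - D.lineWeight (baseB c) (fiberB a b) 0 i =
      b + l • baseB c i := by
  rw [lineWeight_sub, hd']
  simp [fiberB]

include hd hd'

theorem lineWeight_sub_B21 (i : Fin 2) :
    D.lineWeight (baseB c) (fiberB a b) 2 i - D.lineWeight (baseB c) (fiberB a b) 1 i =
      a + b + (k + l) • baseB c i := by
  rw [← sub_add_sub_cancel _ (D.lineWeight (baseB c) (fiberB a b) 0 i),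
    lineWeight_sub_B01 hd, lineWeight_sub_B20 hd', add_smul]
  abel

theorem isEdgeLabel_graphB (e : Fin 9) :
    D.IsEdgeLabel (baseB c) (fiberB a b) (vertexB ((graphB a b c k l).i e))
      (vertexB ((graphB a b c k l).t e)) ((graphB a b c k l).label e) := by
  have h1 := lineWeight_sub_B01 hd a b c
  have h2 := lineWeight_sub_B20 hd' a b c
  have h3 := lineWeight_sub_B21 hd hd' a b c
  fin_cases e <;>
    simp [graphB, vertexB, IsEdgeLabel, baseB_zero, baseB_one, h1, h2, h3, -zsmul_eq_mul]

theorem weights_graphB (v : Fin 6) :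
    (Finset.univ.filter fun e => (graphB a b c k l).i e = v).val.map (graphB a b c k l).label +
      (Finset.univ.filter fun e => (graphB a b c k l).t e = v).val.map
        (fun e => -(graphB a b c k l).label e) =
      Finset.univ.val.map (D.weight (baseB c) (fiberB a b) (vertexB v)) := by
  have h1 := lineWeight_sub_B01 hd a b c
  have h2 := lineWeight_sub_B20 hd' a b c
  have h3 := lineWeight_sub_B21 hd hd' a b c
  have h1' : ∀ i,
      D.lineWeight (baseB c) (fiberB a b) 1 i - D.lineWeight (baseB c) (fiberB a b) 0 i =
        -(a + k • baseB c i) := fun i => by rw [← h1, neg_sub]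
  have h2' : ∀ i,
      D.lineWeight (baseB c) (fiberB a b) 0 i - D.lineWeight (baseB c) (fiberB a b) 2 i =
        -(b + l • baseB c i) := fun i => by rw [← h2, neg_sub]
  have h3' : ∀ i,
      D.lineWeight (baseB c) (fiberB a b) 1 i - D.lineWeight (baseB c) (fiberB a b) 2 i =
        -(a + b + (k + l) • baseB c i) := fun i => by rw [← h3, neg_sub]
  have hu2 : (Finset.univ : Finset (Fin 2)).val = {0, 1} := rfl
  have hu1 : (Finset.univ : Finset (Fin 1)).val = {0} := rfl
  rw [map_weight, show (graphB a b c k l).i = edgeSource from rfl,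
    show (graphB a b c k l).t = edgeTarget from rfl, filter_edgeSource, filter_edgeTarget]
  simp only [hu1, hu2]
  fin_cases v <;>
    simp [graphB, vertexB, baseB_zero, baseB_one, h1, h2, h3, h1', h2', h3', -zsmul_eq_mul,
      Fin.succAbove] <;>
    simp only [← Multiset.singleton_add] <;> abel

theorem describedBy_graphB (B : Module.Basis (Fin 3) ℤ (Fin 3 → ℤ)) {S : Set (CP m × CP 1)}
    (hS : S = D.carrier) {ρ : Torus 3 →* Equiv.Perm S}
    (hρ : ∀ g x, (ρ g x).1 =
      (CP.torusAction (fun c =>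
          D.lineWeight (baseB (B 2)) (fiberB (B 0) (B 1)) (D.σ c) (D.τ c)) g x.1.1,
        CP.torusAction (baseB (B 2)) g x.1.2)) :
    SubmanifoldDescribedBy S ρ (graphB (B 0) (B 1) (B 2) k l) := by
  have h1 := lineWeight_sub_B01 hd (B 0) (B 1) (B 2)
  have h3 := lineWeight_sub_B21 hd hd' (B 0) (B 1) (B 2)
  have hχ : Function.Injective (baseB (B 2)) := by
    intro i i' h
    have h2 : B.repr (baseB (B 2) i) 2 = B.repr (baseB (B 2) i') 2 := by rw [h]
    fin_cases i <;> fin_cases i' <;> simp [baseB] at h2 ⊢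
  have hl : ∀ i, Function.Injective fun j =>
      D.lineWeight (baseB (B 2)) (fiberB (B 0) (B 1)) j i := by
    intro i j j' h
    -- The degrees change the line weights only in the direction of `c`; the `a`- and
    -- `b`-coordinates already separate `0`, `-a`, `b`.
    have hi : ∀ n : Fin 3, n ≠ 2 → B.repr (baseB (B 2) i) n = 0 := by
      intro n hn
      fin_cases i <;> simp [baseB, hn.symm]
    have h0 : B.repr (D.lineWeight (baseB (B 2)) (fiberB (B 0) (B 1)) j i) 0 =
      B.repr (D.lineWeight (baseB (B 2)) (fiberB (B 0) (B 1)) j' i) 0 := congrArg (B.repr · 0) h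
    have h1 : B.repr (D.lineWeight (baseB (B 2)) (fiberB (B 0) (B 1)) j i) 1 =
      B.repr (D.lineWeight (baseB (B 2)) (fiberB (B 0) (B 1)) j' i) 1 := congrArg (B.repr · 1) h
    fin_cases j <;> fin_cases j' <;>
      simp [lineWeight, fiberB, hi 0 (by decide), hi 1 (by decide), -nsmul_eq_mul] at h0 h1 ⊢
  -- Here the weights are `c`, `a`, `a + b`, free of `k` and `l`.
  refine submanifoldDescribedBy hS hρ (by norm_num) (D.weight_ne_zero hχ hl) (ij := (0, 1))
    (fun g hg => ?_) _ vertexB (weights_graphB hd hd' _ _ _) (isEdgeLabel_graphB hd hd' _ _ _)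
  have hc : Torus.char (B 2) g = 1 := by
    simpa [weight, baseB] using hg (Sum.inl 0)
  have ha : Torus.char (B 0) g = 1 := by
    simpa [weight, h1, baseB_zero, Fin.succAbove] using hg (Sum.inr 0)
  have hab : Torus.char (B 0 + B 1) g = 1 := by
    simpa [weight, h3, baseB_zero, Fin.succAbove] using hg (Sum.inr 1)
  refine Torus.eq_one_of_char_basis B fun i => ?_
  fin_cases i
  · exact ha
  · simpa [Torus.char_add, ha] using hab
  · exact hc

end

/-! ## Bundles with arbitrary degrees -/

/-- An enumeration of the pairs of a fibre coordinate and a coordinate of the base. -/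
def pairEquiv (p q : ℕ) : Fin ((q + 1) * p + q + 1) ≃ Fin (q + 1) × Fin (p + 1) :=
  (finCongr (by ring)).trans finProdFinEquiv.symm

/-- The embedding of a sum of line bundles by all the monomials `s_j w_i^{d_j}`. -/
def ofDegrees {p q r : ℕ} (h : p + q = r) (d : Fin (q + 1) → ℕ) :
    SplitBundle p q r ((q + 1) * p + q) where
  σ c := (pairEquiv p q c).1
  τ c := (pairEquiv p q c).2
  d := d
  e j i := (pairEquiv p q).symm (j, i)
  σ_e j i := by rw [Equiv.apply_symm_apply]
  τ_e j i := Or.inr (by rw [Equiv.apply_symm_apply])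
  dim_eq := h

theorem action_mem_carrier {p q r m : ℕ} (D : SplitBundle p q r m) (χ : Fin (p + 1) → Fin r → ℤ)
    (φ : Fin (q + 1) → Fin r → ℤ) (g : Torus r) (x : CP m × CP p) (hx : x ∈ D.carrier) :
    prodAction (CP.torusAction fun c => D.lineWeight χ φ (D.σ c) (D.τ c)) (CP.torusAction χ) g x ∈
      D.carrier := by
  obtain ⟨w, s, hw, hs, rfl⟩ := hx
  refine ⟨_, _, CP.diag_mk_ne_zero (fun i => Torus.char (χ i) g) hw,
    CP.diag_mk_ne_zero (fun j => Torus.char (φ j) g) hs, Prod.ext ?_ rfl⟩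
  refine (CP.diag_mk _ _ _).trans ?_
  congr 1
  exact funext fun c => (D.homog_char_mul χ φ g w s c).symm

/-- The diagonal action of the torus on the total space. -/
def action {p q r m : ℕ} (D : SplitBundle p q r m) (χ : Fin (p + 1) → Fin r → ℤ)
    (φ : Fin (q + 1) → Fin r → ℤ) : Torus r →* Equiv.Perm D.carrier :=
  restrictAction _ D.carrier (D.action_mem_carrier χ φ)

/-! ## The two families -/

/-- The bundle `M₁(k)`. -/
def bundle1 (k : ℕ) : SplitBundle 2 1 3 3 where
  σ := ![0, 0, 0, 1]
  τ := ![0, 1, 2, 0]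
  d := ![k, 0]
  e := ![![0, 1, 2], ![3, 3, 3]]
  σ_e := by decide
  τ_e j i := by
    fin_cases j
    · right
      fin_cases i <;> rfl
    · exact Or.inl rfl
  dim_eq := rfl

/-- The equations make `(z₀, z₁, z₂)` a multiple `t` of `(w₀^k, w₁^k, w₂^k)`, with `t = z_i / w_i^k`
for any `w_i ≠ 0`; the fibre coordinates are `t` and `z₃`. This includes `k = 0`. -/
theorem M1_eq_carrier (k : ℕ) : M1 k = (bundle1 k).carrier := by
  ext x
  constructor
  · rintro ⟨z, w, hz, hw, rfl, h01, h12, h02⟩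
    have key : ∃ t : ℂ, z 0 = t * w 0 ^ k ∧ z 1 = t * w 1 ^ k ∧ z 2 = t * w 2 ^ k := by
      obtain ⟨i, hi⟩ := Function.ne_iff.1 hw
      have hi' : w i ^ k ≠ 0 := pow_ne_zero _ hi
      fin_cases i
      · refine ⟨z 0 / w 0 ^ k, ?_, ?_, ?_⟩ <;> rw [div_mul_eq_mul_div]
        exacts [(eq_div_iff hi').2 rfl, (eq_div_iff hi').2 h01.symm,
          (eq_div_iff hi').2 h02.symm]
      · refine ⟨z 1 / w 1 ^ k, ?_, ?_, ?_⟩ <;> rw [div_mul_eq_mul_div]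
        exacts [(eq_div_iff hi').2 h01, (eq_div_iff hi').2 rfl,
          (eq_div_iff hi').2 h12.symm]
      · refine ⟨z 2 / w 2 ^ k, ?_, ?_, ?_⟩ <;> rw [div_mul_eq_mul_div]
        exacts [(eq_div_iff hi').2 h02, (eq_div_iff hi').2 h12, (eq_div_iff hi').2 rfl]
    obtain ⟨t, h0, h1, h2⟩ := key
    have hF : z = (bundle1 k).homog w ![t, z 3] := by
      funext c
      fin_cases c <;> simp [homog, bundle1, h0, h1, h2]
    have hs : (![t, z 3] : Fin 2 → ℂ) ≠ 0 := by
      intro hs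
      apply hz
      rw [hF, hs]
      funext c
      simp [homog]
    refine ⟨w, ![t, z 3], hw, hs, Prod.ext ?_ rfl⟩
    simp only
    congr 1
  · rintro ⟨w, s, hw, hs, rfl⟩
    refine ⟨_, w, (bundle1 k).homog_ne_zero hw hs, hw, rfl, ?_, ?_, ?_⟩ <;>
      simp [homog, bundle1] <;> ring

/-- The bundle `M₂(k, l)`, with `n = k + l`. -/
def bundle2 (k n : ℕ) : SplitBundle 1 2 3 4 where
  σ := ![0, 1, 2, 0, 2]
  τ := ![0, 0, 0, 1, 1]
  d := ![k, 0, n]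
  e := ![![0, 3], ![1, 1], ![2, 4]]
  σ_e := by decide
  τ_e j i := by
    fin_cases j
    · right
      fin_cases i <;> rfl
    · exact Or.inl rfl
    · right
      fin_cases i <;> rfl
  dim_eq := rfl

/-- The two equations are independent proportionalities, `(z₀, z₃)` to `k`-th powers and `(z₂, z₄)`
to `n`-th powers; their factors `t`, `u` and the free coordinate `z₁` are the fibre coordinates. -/
theorem M2_eq_carrier (k : ℕ) (l : ℤ) : M2 k l = (bundle2 k (k + l).toNat).carrier := by
  generalize hn : (k + l).toNat = n
  ext x
  simp only [M2, hn]
  constructor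
  · rintro ⟨z, w, hz, hw, rfl, h03, h24⟩
    have key : ∃ t u : ℂ, z 0 = t * w 0 ^ k ∧ z 3 = t * w 1 ^ k ∧ z 2 = u * w 0 ^ n ∧
        z 4 = u * w 1 ^ n := by
      obtain ⟨i, hi⟩ := Function.ne_iff.1 hw
      have hik : w i ^ k ≠ 0 := pow_ne_zero _ hi
      have hin : w i ^ n ≠ 0 := pow_ne_zero _ hi
      fin_cases i
      · refine ⟨z 0 / w 0 ^ k, z 2 / w 0 ^ n, ?_, ?_, ?_, ?_⟩ <;> rw [div_mul_eq_mul_div]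
        exacts [(eq_div_iff hik).2 rfl, (eq_div_iff hik).2 h03.symm, (eq_div_iff hin).2 rfl,
          (eq_div_iff hin).2 h24.symm]
      · refine ⟨z 3 / w 1 ^ k, z 4 / w 1 ^ n, ?_, ?_, ?_, ?_⟩ <;> rw [div_mul_eq_mul_div]
        exacts [(eq_div_iff hik).2 h03, (eq_div_iff hik).2 rfl, (eq_div_iff hin).2 h24,
          (eq_div_iff hin).2 rfl]
    obtain ⟨t, u, h0, h3, h2, h4⟩ := key
    have hF : z = (bundle2 k n).homog w ![t, z 1, u] := by
      funext c
      fin_cases c <;> simp [homog, bundle2, h0, h2, h3, h4]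
    have hs : (![t, z 1, u] : Fin 3 → ℂ) ≠ 0 := by
      intro hs
      apply hz
      rw [hF, hs]
      funext c
      simp [homog]
    refine ⟨w, ![t, z 1, u], hw, hs, Prod.ext ?_ rfl⟩
    simp only
    congr 1
  · rintro ⟨w, s, hw, hs, rfl⟩
    refine ⟨_, w, (bundle2 k n).homog_ne_zero hw hs, hw, rfl, ?_, ?_⟩ <;>
      simp [homog, bundle2] <;> ring

end SplitBundle

end

open SplitBundle in
theorem theorem1p2 (B : Module.Basis (Fin 3) ℤ (Fin 3 → ℤ)) :
    (∀ k : ℤ, DescribesSomeManifold (graphA (B 0) (B 1) (B 2) k)) ∧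
    (∀ k l : ℤ, DescribesSomeManifold (graphB (B 0) (B 1) (B 2) k l)) ∧
    (∀ k : ℕ, SubmanifoldDescribedBy (M1 k) (action1 (B 0) (B 1) (B 2) k)
      (graphA (B 0) (B 1) (B 2) k)) ∧
    (∀ (k : ℕ) (l : ℤ) (hkl : 0 ≤ k + l),
      SubmanifoldDescribedBy (M2 k l) (action2 (B 0) (B 1) (B 2) k l hkl)
        (graphB (B 0) (B 1) (B 2) k l)) := by
  refine ⟨fun k => ?_, fun k l => ?_, fun k => ?_, fun k l hkl => ?_⟩
  -- The positive and negative parts of `k` are degrees with difference `k`.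
  · refine SubmanifoldDescribedBy.describesSomeManifold (describedBy_graphA
      (D := ofDegrees rfl ![k.toNat, (-k).toNat]) ?_ B rfl
      (ρ := action _ (baseA (B 0) (B 1)) (fiberA (B 2))) fun g x => rfl)
    simp [ofDegrees]
  -- Adding `|l|` to the first two degrees keeps their difference `k` and makes the third one, the
  -- first plus `l`, nonnegative, so that `toNat` loses nothing.
  · refine SubmanifoldDescribedBy.describesSomeManifold (describedBy_graphB
      (D := ofDegrees rfl ![k.toNat + l.natAbs, (-k).toNat + l.natAbs,
        (k.toNat + l.natAbs + l).toNat]) ?_ ?_ B rfl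
      (ρ := action _ (baseB (B 2)) (fiberB (B 0) (B 1))) fun g x => rfl)
    · simp [ofDegrees]
    · change (((k.toNat + l.natAbs + l).toNat : ℕ) : ℤ) - ((k.toNat + l.natAbs : ℕ) : ℤ) = l
      omega
  · refine describedBy_graphA (D := bundle1 k) (by simp [bundle1]) B (M1_eq_carrier k) fun g x => ?_
    refine Prod.ext ?_ rfl
    refine congrArg (fun ξ => CP.torusAction ξ g x.1.1) (funext fun c => ?_)
    fin_cases c <;> simp [lineWeight, bundle1, baseA, fiberA]
  · obtain ⟨n, hn⟩ := Int.eq_ofNat_of_zero_le hkl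
    refine describedBy_graphB (D := bundle2 k (k + l).toNat) (by simp [bundle2]) ?_ B
      (M2_eq_carrier k l) fun g x => ?_
    · simp [bundle2]
      omega
    · refine Prod.ext ?_ rfl
      refine congrArg (fun ξ => CP.torusAction ξ g x.1.1) (funext fun c => ?_)
      fin_cases c <;> simp [lineWeight, bundle2, baseB, fiberB, hn]
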